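/- **Setting.** Let $\mathbb F$ be a non-Archimedean local field with residue characteristic $p$, let $\mathcal G$ be a connected reductive linear algebraic group over $\mathbb F$, realised as a closed subgroup of some $\mathrm{GL}_n$, and let $G=\mathcal G(\mathbb F)$. Let $P$ and $\bar P$ be opposite parabolic $\mathbb F$-subgroups of $\mathcal G$. Let $M$, $U$, $\bar U$ denote the groups of $\mathbb F$-rational points of the Levi subgroup $P\cap\bar P$ and of the unipotent radicals of $P$ and $\bar P$. Let $R$ be a unital ring (not necessarily commutative) in which $p$ is invertible. Representations of $G$ act by $R$-linear maps on $R$-modules, and they are smooth if every vector is fixed by an open subgroup. For a compact open pro-$p$ subgroup $L\subseteq G$ let $e_L$ be its normalised Haar measure; it acts on a smooth representation $V$ by averaging over $L$ and projects $V$ onto $V^L$. Put $e_{L\lambda L}=e_L\lambda e_L$. *Good position.* A compact open pro-$p$ subgroup $K\subseteq G$ is in good position with respect to $\{P,\bar P\}$ if the multiplication map $(K\cap U)\times(K\cap M)\times(K\cap\bar U)\to K$ is bijective, and likewise for every other ordering of the three factors. *Strict positivity.* An element $\lambda$ of the centre of $M$ is strictly positive with respect to $(\bar P,M)$ (and $K$)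 if $\lambda^n(K\cap U)\lambda^{-n}$, $n\in\mathbb N$, is an increasing sequence with union $U$ and $\bigcap_n\lambda^{-n}(K\cap U)\lambda^{n}=\{1\}$, and also $\lambda^{-n}(K\cap\bar U)\lambda^{n}$, $n\in\mathbb N$, is an increasing sequence with union $\bar U$ and $\bigcap_n\lambda^{n}(K\cap\bar U)\lambda^{-n}=\{1\}$. *Functors.* Let $\delta(m)=p^{e(m)}$, $e(m)\in\mathbb Z$, be the modulus of conjugation by $m\in M$ on $\bar U$, that is, $\delta(m)=[mCm^{-1}:C\cap mCm^{-1}]/[C:C\cap mCm^{-1}]$ with $C=K\cap\bar U$. Fix a central unit $s\in R$ and put $\chi(m)=s^{e(m)}$ (the normalised functors use $s^2=p^{\pm1}$, according to the convention for the modular function; $s=1$ gives the unnormalised functors). For a smooth representation $V$: - $\mathrm r_G^{\bar P}(V)=V/\operatorname{span}\{\bar u v-v: v\in V,\ \bar u\in\bar U\}$, with $M$ acting by the induced action multiplied by $\chi$. - The roughening of $V$ is $\varprojlim_L V^L$, the limit over all compact open pro-$p$ subgroups $L\subseteq G$ with transition maps $e_L\colon V^{L'}\to V^L$ for $L'\subseteq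 L$; $G$ acts on it by $(gx)_L=g\,x_{g^{-1}Lg}$. Then $\mathrm i^{*P}_G(V)$ is the $R$-module of all $U$-invariant and $M$-smooth vectors in the roughening, with $M$ acting by the restricted action multiplied by $\chi$. - The natural map $\mathrm i^{*P}_G(V)\to\mathrm r_G^{\bar P}(V)$ sends $x$ to the class of $e_Lx=x_L\in V^L$, where $L$ is any compact open pro-$p$ subgroup in good position such that $x$ is invariant under $L\cap M$. **Proposition.** Let $K\subseteq G$ be a compact open pro-$p$ subgroup in good position with respect to $\{P,\bar P\}$, let $\lambda$ be strictly positive with respect to $(\bar P,M)$ and $K$, and let $T=e_{K\lambda K}\colon V^K\to V^K$. There are $R$-linear isomorphisms, natural in the smooth representation $V$ of $G$, $$\Phi_V\colon \mathrm r_G^{\bar P}(V)^{K\cap M}\cong\varinjlim\bigl(V^K\xrightarrow{T}V^K\xrightarrow{T}V^K\to\cdots\bigr),\qquad \Psi_V\colon \mathrm i^{*P}_G(V)^{K\cap M}\cong\varprojlim\bigl(\cdots\to V^K\xrightarrow{T}V^K\xrightarrow{T}V^K\bigr).$$ Explicitly, $\Phi_V^{-1}$ sends the image of $y$ in the $n$-th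 copy of $V^K$ to the class of $\lambda^{-n}y$, and $\Psi_V(x)=\bigl((\lambda^{-n}x)_K\bigr)_{n\in\mathbb N}$. Under these isomorphisms, the restriction of the natural map $\mathrm i^{*P}_G(V)\to\mathrm r_G^{\bar P}(V)$ to $(K\cap M)$-invariants becomes the canonical map from the projective to the inductive limit of $\cdots\to V^K\xrightarrow{T}V^K\xrightarrow{T}V^K\to\cdots$, which sends $(y_n)_{n\in\mathbb N}$ to the image of $y_0$ in the copy of $V^K$ with index $0$. In particular, for $x\in\mathrm i^{*P}_G(V)^{K\cap M}$ and every compact open pro-$p$ subgroup $L$ in good position for which $x$ is also $(L\cap M)$-invariant, the class of $x_L$ is $\Phi_V^{-1}$ of the canonical image of $\Psi_V(x)$. -/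

import Mathlib

open scoped Pointwise ValuativeRel MatrixGroups

universe u v w

noncomputable section

/-! ### Linear algebraic groups as Zariski-closed subgroups of `GL_n` -/

namespace AlgGroup

variable {k : Type u} [Field k] {n : ℕ}

/-- The matrix entries of an element of `GL_n(k)`, as a point of affine `n²`-space. -/
def entries (g : GL (Fin n) k) : Fin n × Fin n → k := fun ij => (g : Matrix (Fin n) (Fin n) k) ij.1 ij.2

/-- The subgroup is cut out in `GL_n(k)` by polynomials in the matrix entries. -/
def IsZariskiClosed (H : Subgroup (GL (Fin n) k)) : Prop :=
  ∀ g : GL (Fin n) k, (∀ f ∈ MvPolynomial.vanishingIdeal k (entries '' (H : Set (GL (Fin n) k))),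
    MvPolynomial.eval (entries g) f = 0) → g ∈ H

/-- A Zariski-closed subgroup is connected if it has no proper Zariski-closed subgroup
of finite index. -/
def IsClosedConnected (H : Subgroup (GL (Fin n) k)) : Prop :=
  IsZariskiClosed H ∧
    ∀ N : Subgroup (GL (Fin n) k), N ≤ H → IsZariskiClosed N → N.relIndex H ≠ 0 → N = H

/-- All elements are unipotent matrices. -/
def IsUnipotent (H : Subgroup (GL (Fin n) k)) : Prop :=
  ∀ g ∈ H, IsNilpotent ((g : Matrix (Fin n) (Fin n) k) - 1)

/-- `N` is the unipotent radical of `H`: the largest closed connected unipotent normal subgroup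
of `H`. -/
def IsUnipotentRadical (H N : Subgroup (GL (Fin n) k)) : Prop :=
  IsGreatest {N' : Subgroup (GL (Fin n) k) | N' ≤ H ∧ (∀ h ∈ H, ∀ x ∈ N', h * x * h⁻¹ ∈ N') ∧
    IsClosedConnected N' ∧ IsUnipotent N'} N

/-- Connected reductive group (to be used over an algebraically closed field). -/
def IsConnectedReductive (H : Subgroup (GL (Fin n) k)) : Prop :=
  IsClosedConnected H ∧ IsUnipotentRadical H ⊥

/-- Borel subgroup: a maximal closed connected solvable subgroup. -/
def IsBorel (H B : Subgroup (GL (Fin n) k)) : Prop :=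
  Maximal (fun B' : Subgroup (GL (Fin n) k) => B' ≤ H ∧ IsClosedConnected B' ∧ Group.IsSolvable B') B

/-- Parabolic subgroup: a closed subgroup that contains a Borel subgroup. -/
def IsParabolic (H P : Subgroup (GL (Fin n) k)) : Prop :=
  P ≤ H ∧ IsZariskiClosed P ∧ ∃ B, IsBorel H B ∧ B ≤ P

variable (F : Type v) [Field F] [Algebra F k]

/-- The vanishing ideal over `k` is generated by polynomials with coefficients in `F`. -/
def IsDefinedOver (H : Subgroup (GL (Fin n) k)) : Prop :=
  MvPolynomial.vanishingIdeal k (entries '' (H : Set (GL (Fin n) k))) =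
    (MvPolynomial.vanishingIdeal F (entries '' (H : Set (GL (Fin n) k)))).map
      (MvPolynomial.map (algebraMap F k))

/-- The group of `F`-rational points, a subgroup of `GL_n(F)`. -/
def points (H : Subgroup (GL (Fin n) k)) : Subgroup (GL (Fin n) F) :=
  H.comap (Matrix.GeneralLinearGroup.map (algebraMap F k))

/-- `P` and `Q` are opposite parabolic `F`-subgroups of `H` with unipotent radicals `U` and `Ubar`:
both are parabolic and defined over `F`, and `P ∩ Q` is a Levi subgroup of both, that is, a
complement of `U` in `P` and of `Ubar` in `Q`. -/
structure IsOppositeParabolicPair (H P Q U Ubar : Subgroup (GL (Fin n) k)) : Prop where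
  parabolic_left : IsParabolic H P
  parabolic_right : IsParabolic H Q
  definedOver_left : IsDefinedOver F P
  definedOver_right : IsDefinedOver F Q
  radical_left : IsUnipotentRadical P U
  radical_right : IsUnipotentRadical Q Ubar
  levi_left_inf : (P ⊓ Q) ⊓ U = ⊥
  levi_left_sup : (P ⊓ Q) ⊔ U = P
  levi_right_inf : (P ⊓ Q) ⊓ Ubar = ⊥
  levi_right_sup : (P ⊓ Q) ⊔ Ubar = Q

end AlgGroup

/-! ### Parabolic decompositions in a topological group -/

/-- Subgroups `U`, `M`, `Ubar` of `G` such that `M` normalises `U` and `Ubar`. -/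
structure LeviTriple (G : Type u) [Group G] where
  U : Subgroup G
  M : Subgroup G
  Ubar : Subgroup G
  conj_U : ∀ m ∈ M, ∀ x ∈ U, m * x * m⁻¹ ∈ U
  conj_Ubar : ∀ m ∈ M, ∀ x ∈ Ubar, m * x * m⁻¹ ∈ Ubar

/-- The groups of `F`-rational points of `U`, `P ∩ Q` and `Ubar`, as subgroups of the group of
`F`-rational points of `H`. -/
def AlgGroup.leviTriple {k : Type u} [Field k] {n : ℕ} {F : Type v} [Field F] [Algebra F k]
    {H P Q U Ubar : Subgroup (GL (Fin n) k)}
    (h : AlgGroup.IsOppositeParabolicPair F H P Q U Ubar) : LeviTriple (AlgGroup.points F H) where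
  U := (AlgGroup.points F U).subgroupOf (AlgGroup.points F H)
  M := (AlgGroup.points F (P ⊓ Q)).subgroupOf (AlgGroup.points F H)
  Ubar := (AlgGroup.points F Ubar).subgroupOf (AlgGroup.points F H)
  conj_U := by
    rintro m hm x hx
    have hc := h.radical_left.1.2.1 _ (Subgroup.mem_inf.1 hm).1 _ hx
    refine (?_ : Matrix.GeneralLinearGroup.map (algebraMap F k)
      ((m : GL (Fin n) F) * (x : GL (Fin n) F) * (m : GL (Fin n) F)⁻¹) ∈ U)
    rw [map_mul, map_mul, map_inv]
    exact hc
  conj_Ubar := by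
    rintro m hm x hx
    have hc := h.radical_right.1.2.1 _ (Subgroup.mem_inf.1 hm).2 _ hx
    refine (?_ : Matrix.GeneralLinearGroup.map (algebraMap F k)
      ((m : GL (Fin n) F) * (x : GL (Fin n) F) * (m : GL (Fin n) F)⁻¹) ∈ Ubar)
    rw [map_mul, map_mul, map_inv]
    exact hc

/-- Pro-`p`-group: a compact totally disconnected group all of whose open normal subgroups have
`p`-power index. -/
structure IsProP (p : ℕ) (H : Type u) [Group H] [TopologicalSpace H] : Prop where
  compact : CompactSpace H
  totallyDisconnected : TotallyDisconnectedSpace H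
  index_eq : ∀ N : Subgroup H, N.Normal → IsOpen (N : Set H) → ∃ e : ℕ, N.index = p ^ e

/-- The compact open pro-`p` subgroups of `G`. -/
structure CompactOpenProP (p : ℕ) (G : Type u) [Group G] [TopologicalSpace G] where
  toSubgroup : Subgroup G
  isOpen : IsOpen (toSubgroup : Set G)
  isProP : IsProP p toSubgroup

section Position

variable {G : Type u} [Group G]

/-- Multiplication `A × B × C → K` is (well-defined and) bijective. -/
def FactorsAs (K A B C : Subgroup G) : Prop :=
  Set.BijOn (fun x : G × G × G => x.1 * x.2.1 * x.2.2)
    ((A : Set G) ×ˢ (B : Set G) ×ˢ (C : Set G)) (K : Set G)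

/-- The decomposition property of a subgroup in good position, for all six orderings. -/
def LeviTriple.IsInGoodPosition (D : LeviTriple G) (K : Subgroup G) : Prop :=
  FactorsAs K (K ⊓ D.U) (K ⊓ D.M) (K ⊓ D.Ubar) ∧
  FactorsAs K (K ⊓ D.U) (K ⊓ D.Ubar) (K ⊓ D.M) ∧
  FactorsAs K (K ⊓ D.M) (K ⊓ D.U) (K ⊓ D.Ubar) ∧
  FactorsAs K (K ⊓ D.M) (K ⊓ D.Ubar) (K ⊓ D.U) ∧
  FactorsAs K (K ⊓ D.Ubar) (K ⊓ D.U) (K ⊓ D.M) ∧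
  FactorsAs K (K ⊓ D.Ubar) (K ⊓ D.M) (K ⊓ D.U)

/-- `z` is a central element of `M` that is strictly positive with respect to `(Ubar M, M)`:
conjugation by `z` expands `K ∩ U` to an increasing sequence exhausting `U`, conjugation by `z⁻¹`
shrinks `K ∩ U` to `1`, and the same holds for `z⁻¹` and `K ∩ Ubar`. -/
structure LeviTriple.IsStrictlyPositive (D : LeviTriple G) (K : Subgroup G) (z : G) : Prop where
  mem_center : z ∈ (Subgroup.center D.M).map D.M.subtype
  U_le : K ⊓ D.U ≤ MulAut.conj z • (K ⊓ D.U)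
  U_iUnion : ⋃ n : ℕ, ((MulAut.conj (z ^ n) • (K ⊓ D.U) : Subgroup G) : Set G) = D.U
  U_iInf : ⨅ n : ℕ, (MulAut.conj ((z ^ n)⁻¹) • (K ⊓ D.U) : Subgroup G) = ⊥
  Ubar_le : K ⊓ D.Ubar ≤ MulAut.conj (z⁻¹) • (K ⊓ D.Ubar)
  Ubar_iUnion : ⋃ n : ℕ, ((MulAut.conj ((z ^ n)⁻¹) • (K ⊓ D.Ubar) : Subgroup G) : Set G) = D.Ubar
  Ubar_iInf : ⨅ n : ℕ, (MulAut.conj (z ^ n) • (K ⊓ D.Ubar) : Subgroup G) = ⊥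

/-- The exponent `e(m)` in the modulus `p ^ e(m) = [m C m⁻¹ : C ∩ m C m⁻¹] / [C : C ∩ m C m⁻¹]`
of conjugation by `m`; here `C` is a compact open pro-`p` subgroup of `Ubar`. -/
def modulusExponent (p : ℕ) (C : Subgroup G) (m : G) : ℤ :=
  (padicValNat p (C.relIndex (MulAut.conj m • C)) : ℤ) -
    (padicValNat p ((MulAut.conj m • C).relIndex C) : ℤ)

/-- The twist `s ^ e(m)`. If `s² = p`, this is the square root of the modulus; if `s = 1`, there is
no twist. -/
def modularTwist (p : ℕ) {R : Type v} [Ring R] (s : (Subring.center R)ˣ) (C : Subgroup G) (m : G) :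
    Subring.center R :=
  ((s ^ modulusExponent p C m : (Subring.center R)ˣ) : Subring.center R)

end Position

namespace CompactOpenProP

variable {p : ℕ} {G : Type u} [Group G] [TopologicalSpace G] [IsTopologicalGroup G]

theorem exists_index_eq (L : CompactOpenProP p G) (N : Subgroup L.toSubgroup)
    (hN : IsOpen (N : Set L.toSubgroup)) : N.index ≠ 0 ∧ ∃ e : ℕ, N.index ∣ p ^ e := by
  have := L.isProP.compact
  have hfin : N.FiniteIndex := by
    have := Subgroup.quotient_finite_of_isOpen N hN
    exact Subgroup.finiteIndex_of_finite_quotient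
  have hopen : IsOpen (N.normalCore : Set L.toSubgroup) :=
    Subgroup.isOpen_of_isClosed_of_finiteIndex _
      (Subgroup.normalCore_isClosed N (Subgroup.isClosed_of_isOpen N hN))
  obtain ⟨e, he⟩ := L.isProP.index_eq N.normalCore inferInstance hopen
  exact ⟨hfin.index_ne_zero, e, he ▸ Subgroup.index_dvd_of_le N.normalCore_le⟩

/-- The conjugate `g L g⁻¹`. -/
def conj (g : G) (L : CompactOpenProP p G) : CompactOpenProP p G where
  toSubgroup := L.toSubgroup.map (MulAut.conj g).toMonoidHom
  isOpen := by
    have h : ((L.toSubgroup.map (MulAut.conj g).toMonoidHom : Subgroup G) : Set G) =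
        (fun x => g⁻¹ * x * g) ⁻¹' (L.toSubgroup : Set G) := by
      ext x
      simp only [SetLike.mem_coe, Subgroup.mem_map, Set.mem_preimage]
      constructor
      · rintro ⟨y, hy, rfl⟩
        simpa [mul_assoc] using hy
      · intro hx
        exact ⟨_, hx, by simp [mul_assoc]⟩
    rw [h]
    exact L.isOpen.preimage (by fun_prop)
  isProP := by
    let E : L.toSubgroup ≃* L.toSubgroup.map (MulAut.conj g).toMonoidHom :=
      L.toSubgroup.equivMapOfInjective _ (MulAut.conj g).injective
    have hE : ∀ x, ((E x : _) : G) = g * x * g⁻¹ := fun x => rfl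
    have hEc : Continuous E := by
      refine continuous_induced_rng.2 ?_
      change Continuous fun x : L.toSubgroup => g * (x : G) * g⁻¹
      fun_prop
    have hEs : ∀ y, ((E.symm y : _) : G) = g⁻¹ * y * g := by
      intro y
      obtain ⟨x, rfl⟩ := E.surjective y
      rw [E.symm_apply_apply, hE]
      group
    have hEsc : Continuous E.symm := by
      refine continuous_induced_rng.2 ?_
      have : (Subtype.val ∘ E.symm) =
          fun y : L.toSubgroup.map (MulAut.conj g).toMonoidHom => g⁻¹ * (y : G) * g := funext hEs
      rw [this]
      fun_prop
    let e : L.toSubgroup ≃ₜ L.toSubgroup.map (MulAut.conj g).toMonoidHom :=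
      { E.toEquiv with continuous_toFun := hEc, continuous_invFun := hEsc }
    have h1 := L.isProP.compact
    have h2 := L.isProP.totallyDisconnected
    refine ⟨e.compactSpace, ?_, fun N hN hNo => ?_⟩
    · exact e.totallyDisconnectedSpace
    · obtain ⟨a, ha⟩ := L.isProP.index_eq (N.comap E.toMonoidHom) inferInstance
        (hNo.preimage hEc)
      exact ⟨a, by rw [← ha, Subgroup.index_comap_of_surjective _ E.surjective]⟩

end CompactOpenProP

/-! ### Smooth representations -/

/-- Smooth representations of `G` on modules over the (not necessarily commutative) ring `R`. -/
structure SmoothRep (R : Type v) (G : Type u) [Ring R] [Group G] [TopologicalSpace G] where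
  V : Type w
  [addCommGroup : AddCommGroup V]
  [module : Module R V]
  ρ : Representation R G V
  smooth : ∀ x : V, ∃ N : Subgroup G, IsOpen (N : Set G) ∧ ∀ g ∈ N, ρ g x = x

attribute [instance] SmoothRep.addCommGroup SmoothRep.module

namespace SmoothRep

variable {R : Type v} {G : Type u} [Ring R] [Group G] [TopologicalSpace G]

/-- Homomorphisms of representations. -/
structure Hom (X Y : SmoothRep.{u, v, w} R G) where
  toLin : X.V →ₗ[R] Y.V
  comm : ∀ (g : G) (x : X.V), toLin (X.ρ g x) = Y.ρ g (toLin x)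

variable (X : SmoothRep.{u, v, w} R G)

/-- The `H`-invariant vectors. -/
def inv (H : Subgroup G) : Submodule R X.V where
  carrier := {x | ∀ h ∈ H, X.ρ h x = x}
  add_mem' := fun hx hy h hh => by rw [map_add, hx h hh, hy h hh]
  zero_mem' := fun h _ => map_zero _
  smul_mem' := fun r x hx h hh => by rw [map_smul, hx h hh]

/-- The orbit of a vector under a subgroup. -/
def orbit (H : Subgroup G) (x : X.V) : Set X.V := (fun h => X.ρ h x) '' (H : Set G)

/-- The average of `x` over its (finite) orbit, that is, the integral of `h • x` with respect to the
normalised Haar measure of `H`. -/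
def average (H : Subgroup G) (x : X.V) : X.V :=
  Ring.inverse ((X.orbit H x).ncard : R) • ∑ᶠ y ∈ X.orbit H x, y

section Average

variable {p : ℕ}

theorem isUnit_of_dvd [hp : Fact (IsUnit (p : R))] {m e : ℕ} (h : m ∣ p ^ e) :
    IsUnit (m : R) := by
  obtain ⟨c, hc⟩ := h
  have h1 : IsUnit ((m : R) * (c : R)) := by
    rw [← Nat.cast_mul, ← hc, Nat.cast_pow]
    exact hp.out.pow e
  exact ((Nat.cast_commute m (c : R)).isUnit_mul_iff.1 h1).1

theorem average_eq [IsTopologicalGroup G] [hp : Fact (IsUnit (p : R))] (L : CompactOpenProP p G)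
    (N : Subgroup L.toSubgroup) (hN : IsOpen (N : Set L.toSubgroup)) (x : X.V)
    (hx : ∀ g ∈ N, X.ρ (g : G) x = x) :
    X.average L.toSubgroup x = Ring.inverse (N.index : R) •
      ∑ᶠ q : L.toSubgroup ⧸ N, X.ρ ((q.out : L.toSubgroup) : G) x := by
  classical
  obtain ⟨hne, e, he⟩ := L.exists_index_eq N hN
  have hfi : N.FiniteIndex := ⟨hne⟩
  have : Fintype (L.toSubgroup ⧸ N) := Fintype.ofFinite _
  set φ : L.toSubgroup ⧸ N → X.V := fun q => X.ρ ((q.out : L.toSubgroup) : G) x with hφ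
  have hmk : ∀ h : L.toSubgroup, φ (QuotientGroup.mk h) = X.ρ (h : G) x := by
    intro h
    obtain ⟨a, ha⟩ := QuotientGroup.mk_out_eq_mul N h
    simp only [hφ, ha, Subgroup.coe_mul, map_mul, Module.End.mul_apply, hx a a.2]
  have horb : X.orbit L.toSubgroup x = ((Finset.univ.image φ : Finset X.V) : Set X.V) := by
    ext y
    simp only [orbit, Set.mem_image, SetLike.mem_coe, Finset.coe_image, Finset.coe_univ,
      Set.image_univ, Set.mem_range]
    constructor
    · rintro ⟨h, hh, rfl⟩
      exact ⟨QuotientGroup.mk ⟨h, hh⟩, hmk _⟩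
    · rintro ⟨q, rfl⟩
      exact ⟨_, q.out.2, rfl⟩
  set c := (Finset.univ.filter fun q => φ q = x).card with hc
  have hfib : ∀ y ∈ Finset.univ.image φ, (Finset.univ.filter fun q => φ q = y).card = c := by
    intro y hy
    obtain ⟨q, -, rfl⟩ := Finset.mem_image.1 hy
    obtain ⟨h, rfl⟩ := QuotientGroup.mk_surjective q
    rw [hmk, hc]
    symm
    refine Finset.card_bij (fun q _ => h • q) ?_ ?_ ?_
    · intro q hq
      obtain ⟨g, rfl⟩ := QuotientGroup.mk_surjective q
      have hq' := (Finset.mem_filter.1 hq).2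
      rw [hmk] at hq'
      refine Finset.mem_filter.2 ⟨Finset.mem_univ _, ?_⟩
      have : h • (QuotientGroup.mk g : L.toSubgroup ⧸ N) = QuotientGroup.mk (h * g) := rfl
      rw [this, hmk, Subgroup.coe_mul, map_mul, Module.End.mul_apply, hq']
    · intro a _ b _ hab
      exact smul_left_cancel h hab
    · intro q hq
      obtain ⟨g, rfl⟩ := QuotientGroup.mk_surjective q
      have hq' := (Finset.mem_filter.1 hq).2
      rw [hmk] at hq'
      refine ⟨QuotientGroup.mk (h⁻¹ * g), Finset.mem_filter.2 ⟨Finset.mem_univ _, ?_⟩, ?_⟩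
      · rw [hmk, Subgroup.coe_mul, map_mul, Module.End.mul_apply, hq', ← Module.End.mul_apply,
          ← map_mul, ← Subgroup.coe_mul]
        simp
      · change QuotientGroup.mk (h * (h⁻¹ * g)) = _
        simp
  have hsum : ∑ᶠ q, φ q = c • ∑ y ∈ Finset.univ.image φ, y := by
    rw [finsum_eq_sum_of_fintype]
    have := Finset.sum_comp (s := Finset.univ) (fun y : X.V => y) φ
    rw [this, Finset.smul_sum]
    exact Finset.sum_congr rfl fun y hy => by rw [hfib y hy]
  have hcard : N.index = (Finset.univ.image φ).card * c := by
    rw [Subgroup.index_eq_card, Nat.card_eq_fintype_card, ← Finset.card_univ]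
    rw [Finset.card_eq_sum_card_image φ, Finset.sum_congr rfl hfib, Finset.sum_const, smul_eq_mul]
  have hu1 : IsUnit ((Finset.univ.image φ).card : R) :=
    isUnit_of_dvd (p := p) ((Dvd.intro _ hcard.symm).trans he)
  have hu2 : IsUnit (c : R) := isUnit_of_dvd (p := p) ((Dvd.intro_left _ hcard.symm).trans he)
  rw [hsum, average, horb, Set.ncard_coe_finset, finsum_mem_coe_finset, hcard, Nat.cast_mul,
    Ring.mul_inverse_rev' (Nat.cast_commute _ _), ← Nat.cast_smul_eq_nsmul R c, smul_smul, mul_assoc]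
  congr 1
  have hcomm : Commute (Ring.inverse ((Finset.univ.image φ).card : R)) (c : R) :=
    (Nat.cast_commute c _).symm
  rw [hcomm.eq, ← mul_assoc, Ring.inverse_mul_cancel _ hu2, one_mul]

/-- The stabiliser of `x` in `L`. -/
def stab (L : Subgroup G) (x : X.V) : Subgroup L where
  carrier := {g | X.ρ (g : G) x = x}
  mul_mem' := by
    intro a b ha hb
    simp only [Set.mem_ofPred_eq, Subgroup.coe_mul, map_mul, Module.End.mul_apply] at *
    rw [hb, ha]
  one_mem' := by simp
  inv_mem' := by
    intro a ha
    simp only [Set.mem_ofPred_eq, Subgroup.coe_inv] at *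
    conv_lhs => rw [← ha]
    rw [← Module.End.mul_apply, ← map_mul]
    simp

theorem isOpen_stab [IsTopologicalGroup G] (L : Subgroup G) (x : X.V) :
    IsOpen (X.stab L x : Set L) := by
  obtain ⟨N, hN, hNx⟩ := X.smooth x
  have h : IsOpen ((N.subgroupOf L : Subgroup L) : Set L) := hN.preimage continuous_subtype_val
  exact Subgroup.isOpen_mono (H₁ := N.subgroupOf L) (fun g hg => hNx g hg) h

/-- The action of the idempotent of `L` (normalised Haar measure) on a smooth representation. -/
def idem [IsTopologicalGroup G] [Fact (IsUnit (p : R))] (L : CompactOpenProP p G) :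
    X.V →ₗ[R] X.V where
  toFun := X.average L.toSubgroup
  map_add' := by
    intro x y
    have ho : IsOpen ((X.stab L.toSubgroup x ⊓ X.stab L.toSubgroup y :
        Subgroup L.toSubgroup) : Set L.toSubgroup) :=
      (X.isOpen_stab L.toSubgroup x).inter (X.isOpen_stab L.toSubgroup y)
    have hfi : (X.stab L.toSubgroup x ⊓ X.stab L.toSubgroup y).FiniteIndex :=
      ⟨(L.exists_index_eq _ ho).1⟩
    rw [X.average_eq L _ ho x fun g hg => hg.1, X.average_eq L _ ho y fun g hg => hg.2,
      X.average_eq L _ ho (x + y) fun g hg => by rw [map_add, hg.1, hg.2], ← smul_add,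
      ← finsum_add_distrib (Set.toFinite _) (Set.toFinite _)]
    simp only [map_add]
  map_smul' := by
    intro r x
    have ho := X.isOpen_stab L.toSubgroup x
    have hfi : (X.stab L.toSubgroup x).FiniteIndex := ⟨(L.exists_index_eq _ ho).1⟩
    rw [X.average_eq L _ ho x fun g hg => hg,
      X.average_eq L _ ho (r • x) fun g hg => by rw [map_smul]; exact congrArg (r • ·) hg]
    simp only [map_smul, RingHom.id_apply]
    rw [← smul_finsum' _ (Set.toFinite _), smul_smul, smul_smul]
    congr 1
    obtain ⟨_, e, he⟩ := L.exists_index_eq _ ho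
    obtain ⟨c, hc⟩ := isUnit_of_dvd (R := R) he
    have h : Commute (c : R) r := hc ▸ Nat.cast_commute _ r
    rw [← hc, Ring.inverse_unit]
    exact h.units_inv_left.eq

/-- The idempotent of `L` maps to `L`-invariant vectors. -/
theorem idem_mem_inv [IsTopologicalGroup G] [Fact (IsUnit (p : R))] (L : CompactOpenProP p G)
    (x : X.V) : X.idem L x ∈ X.inv L.toSubgroup := by
  intro h hh
  have hbij : Set.BijOn (fun y => X.ρ h y) (X.orbit L.toSubgroup x) (X.orbit L.toSubgroup x) := by
    refine ⟨?_, ?_, ?_⟩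
    · rintro _ ⟨g, hg, rfl⟩
      exact ⟨h * g, L.toSubgroup.mul_mem hh hg, by simp⟩
    · intro a _ b _ hab
      have := congrArg (X.ρ h⁻¹) hab
      simpa [← Module.End.mul_apply, ← map_mul] using this
    · rintro _ ⟨g, hg, rfl⟩
      refine ⟨_, ⟨h⁻¹ * g, L.toSubgroup.mul_mem (L.toSubgroup.inv_mem hh) hg, rfl⟩, ?_⟩
      simp [← Module.End.mul_apply, ← map_mul]
  have hfin : (X.orbit L.toSubgroup x).Finite := by
    have ho := X.isOpen_stab L.toSubgroup x
    have hfi : (X.stab L.toSubgroup x).FiniteIndex := ⟨(L.exists_index_eq _ ho).1⟩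
    refine (Set.finite_range fun q : L.toSubgroup ⧸ X.stab L.toSubgroup x =>
      X.ρ ((q.out : L.toSubgroup) : G) x).subset ?_
    rintro _ ⟨g, hg, rfl⟩
    obtain ⟨a, ha⟩ := QuotientGroup.mk_out_eq_mul (X.stab L.toSubgroup x) ⟨g, hg⟩
    refine ⟨QuotientGroup.mk ⟨g, hg⟩, ?_⟩
    have hax : X.ρ (((a : L.toSubgroup)) : G) x = x := a.2
    simp only [ha, Subgroup.coe_mul, map_mul, Module.End.mul_apply, hax]
  change X.ρ h (X.average L.toSubgroup x) = X.average L.toSubgroup x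
  rw [average, map_smul, finsum_mem_eq_finite_toFinset_sum _ hfin, map_sum,
    ← finsum_mem_eq_finite_toFinset_sum (fun y => X.ρ h y) hfin, ← finsum_mem_eq_finite_toFinset_sum (fun y => y) hfin]
  congr 1
  exact finsum_mem_eq_of_bijOn _ hbij fun _ _ => rfl

/-- The operator `e_{KzK} = e_K z e_K` on `V^K`. -/
def hecke [IsTopologicalGroup G] [Fact (IsUnit (p : R))] (K : CompactOpenProP p G) (z : G) :
    Module.End R (X.inv K.toSubgroup) :=
  (X.idem K ∘ₗ X.ρ z ∘ₗ X.idem K).restrict fun _ _ => X.idem_mem_inv K _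

theorem Hom.idem_comm {X Y : SmoothRep.{u, v, w} R G} (f : X.Hom Y) [IsTopologicalGroup G]
    [Fact (IsUnit (p : R))] (L : CompactOpenProP p G) (x : X.V) :
    f.toLin (X.idem L x) = Y.idem L (f.toLin x) := by
  have ho := X.isOpen_stab L.toSubgroup x
  have hfi : (X.stab L.toSubgroup x).FiniteIndex := ⟨(L.exists_index_eq _ ho).1⟩
  change f.toLin (X.average L.toSubgroup x) = Y.average L.toSubgroup (f.toLin x)
  rw [X.average_eq L _ ho x fun g hg => hg,
    Y.average_eq L _ ho (f.toLin x) fun g hg => by rw [← f.comm]; exact congrArg f.toLin hg,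
    map_smul, map_finsum _ (Set.toFinite _)]
  simp only [f.comm]

end Average

/-- The map on `H`-invariants induced by a homomorphism. -/
def Hom.onInv {X Y : SmoothRep.{u, v, w} R G} (f : X.Hom Y) (H : Subgroup G) :
    X.inv H →ₗ[R] Y.inv H :=
  f.toLin.restrict fun x hx h hh => by rw [← f.comm, hx h hh]

theorem Hom.onInv_hecke {X Y : SmoothRep.{u, v, w} R G} (f : X.Hom Y) [IsTopologicalGroup G]
    {p : ℕ} [Fact (IsUnit (p : R))] (K : CompactOpenProP p G) (z : G) :
    f.onInv K.toSubgroup ∘ₗ X.hecke K z = Y.hecke K z ∘ₗ f.onInv K.toSubgroup := by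
  ext x
  change f.toLin (X.idem K (X.ρ z (X.idem K x))) = Y.idem K (Y.ρ z (Y.idem K (f.toLin x)))
  rw [f.idem_comm, f.comm, f.idem_comm]

end SmoothRep

/-! ### Limits of the constant system given by an endomorphism -/

section Limits

variable {R : Type v} [Ring R] {W : Type w} [AddCommGroup W] [Module R W]

/-- The inductive limit of `W → W → W → ⋯` with all maps equal to `T`. -/
abbrev IndLim (T : Module.End R W) : Type w :=
  Module.DirectLimit (fun _ : ℕ => W) (fun i j (_ : i ≤ j) => T ^ (j - i))

/-- The canonical map from the `n`-th copy of `W` to the inductive limit. -/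
def IndLim.of (T : Module.End R W) (n : ℕ) : W →ₗ[R] IndLim T :=
  Module.DirectLimit.of R ℕ (fun _ : ℕ => W) (fun i j (_ : i ≤ j) => T ^ (j - i)) n

/-- Functoriality of the inductive limit. -/
def IndLim.map {W' : Type w} [AddCommGroup W'] [Module R W'] {T : Module.End R W}
    {T' : Module.End R W'} (g : W →ₗ[R] W') (h : g ∘ₗ T = T' ∘ₗ g) : IndLim T →ₗ[R] IndLim T' :=
  Module.DirectLimit.map (fun _ => g) fun i j _ => by
    induction j - i with
    | zero => rfl
    | succ n ih =>
      rw [pow_succ, pow_succ, Module.End.mul_eq_comp, Module.End.mul_eq_comp, ← LinearMap.comp_assoc,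
        ih, LinearMap.comp_assoc, h, LinearMap.comp_assoc]

/-- The projective limit of `⋯ → W → W → W` with all maps equal to `T`. -/
def ProjLim (T : Module.End R W) : Submodule R (ℕ → W) where
  carrier := {x | ∀ n, T (x (n + 1)) = x n}
  add_mem' := fun hx hy n => by simp [hx n, hy n]
  zero_mem' := fun n => by simp
  smul_mem' := fun r x hx n => by simp [hx n]

/-- Functoriality of the projective limit. -/
def ProjLim.map {W' : Type w} [AddCommGroup W'] [Module R W'] {T : Module.End R W}
    {T' : Module.End R W'} (g : W →ₗ[R] W') (h : g ∘ₗ T = T' ∘ₗ g) : ProjLim T →ₗ[R] ProjLim T' :=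
  (LinearMap.pi fun n => g ∘ₗ LinearMap.proj n).restrict fun x hx n => by
    change T' (g (x (n + 1))) = g (x n)
    rw [← hx n]
    exact (LinearMap.congr_fun h (x (n + 1))).symm

/-- The canonical map from the projective to the inductive limit of
`⋯ → W → W → W → ⋯`. -/
def projToInd (T : Module.End R W) : ProjLim T →ₗ[R] IndLim T :=
  IndLim.of T 0 ∘ₗ LinearMap.proj 0 ∘ₗ (ProjLim T).subtype

end Limits

/-! ### Jacquet functors -/

namespace LeviTriple

variable {p : ℕ} {R : Type v} {G : Type u} [Ring R] [Group G] [TopologicalSpace G]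
  (D : LeviTriple G)

section Restriction

variable (X : SmoothRep.{u, v, w} R G)

/-- The submodule spanned by all `u • x - x` with `u ∈ Ubar`. -/
def coinvSub : Submodule R X.V :=
  Submodule.span R {y | ∃ g ∈ D.Ubar, ∃ x : X.V, y = X.ρ g x - x}

/-- The `Ubar`-coinvariants, the `R`-module underlying the Jacquet module. -/
abbrev Jacquet : Type w := X.V ⧸ D.coinvSub X

/-- The action of `m ∈ M` on the `Ubar`-coinvariants induced by the action of `G` on `V`. -/
def jacquetAct (m : D.M) : Module.End R (D.Jacquet X) :=
  Submodule.mapQ _ _ (X.ρ m) <| Submodule.span_le.2 <| by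
    rintro _ ⟨g, hg, x, rfl⟩
    refine Submodule.subset_span ⟨m * g * (m : G)⁻¹, D.conj_Ubar m m.2 g hg, X.ρ m x, ?_⟩
    simp [← Module.End.mul_apply, ← map_mul]

/-- The vectors in the Jacquet module `r(V)` that are invariant under `S ∩ M`, where `M` acts by
`m ↦ χ(m) m`. -/
def jacquetInv (χ : G → Subring.center R) (S : Subgroup G) : Submodule R (D.Jacquet X) :=
  ⨅ m : D.M, ⨅ _ : (m : G) ∈ S, LinearMap.ker (χ m • D.jacquetAct X m - 1)

end Restriction

section Naturality

variable {X Y : SmoothRep.{u, v, w} R G}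

/-- The map on Jacquet modules induced by a homomorphism. -/
def jacquetMap (f : X.Hom Y) : D.Jacquet X →ₗ[R] D.Jacquet Y :=
  Submodule.mapQ _ _ f.toLin <| Submodule.span_le.2 <| by
    rintro _ ⟨g, hg, x, rfl⟩
    exact Submodule.subset_span ⟨g, hg, f.toLin x, by rw [map_sub, f.comm]⟩

/-- The map on `S ∩ M`-invariants of Jacquet modules induced by a homomorphism. -/
def jacquetInvMap (f : X.Hom Y) (χ : G → Subring.center R) (S : Subgroup G) :
    D.jacquetInv X χ S →ₗ[R] D.jacquetInv Y χ S :=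
  (D.jacquetMap f).restrict fun q hq => by
    simp only [jacquetInv, Submodule.mem_iInf, LinearMap.mem_ker, LinearMap.sub_apply,
      sub_eq_zero] at hq ⊢
    intro m hm
    have h1 : D.jacquetAct Y m (D.jacquetMap f q) = D.jacquetMap f (D.jacquetAct X m q) := by
      obtain ⟨x, rfl⟩ := Submodule.mkQ_surjective _ q
      exact congrArg (D.coinvSub Y).mkQ (f.comm m x).symm
    have h2 := congrArg (D.jacquetMap f) (hq m hm)
    rw [LinearMap.smul_apply, Subring.smul_def, map_smul] at h2
    rw [LinearMap.smul_apply, Subring.smul_def, h1]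
    exact h2

end Naturality

section Adjoint

variable [IsTopologicalGroup G] (X : SmoothRep.{u, v, w} R G)

variable (p) in
/-- The action of `g ∈ G` on families indexed by the compact open pro-`p` subgroups:
`(g x)_L = g x_{g⁻¹ L g}`. -/
def roughAct (g : G) : Module.End R (CompactOpenProP p G → X.V) :=
  LinearMap.pi fun L => X.ρ g ∘ₗ LinearMap.proj (CompactOpenProP.conj g⁻¹ L)

variable (p) in
/-- The roughening of `V`: the projective limit of the spaces `V^L` for the compact open pro-`p`
subgroups `L` of `G`, with transition maps `e_L : V^{L'} → V^L` for `L' ⊆ L`. -/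
def rough [Fact (IsUnit (p : R))] : Submodule R (CompactOpenProP p G → X.V) where
  carrier := {x | (∀ L, x L ∈ X.inv L.toSubgroup) ∧
    ∀ L' L : CompactOpenProP p G, L'.toSubgroup ≤ L.toSubgroup → X.idem L (x L') = x L}
  add_mem' := fun hx hy => ⟨fun L => (X.inv L.toSubgroup).add_mem (hx.1 L) (hy.1 L),
    fun L' L h => by simp [hx.2 L' L h, hy.2 L' L h]⟩
  zero_mem' := ⟨fun L => (X.inv L.toSubgroup).zero_mem, fun L' L _ => by simp⟩
  smul_mem' := fun r x hx => ⟨fun L => (X.inv L.toSubgroup).smul_mem r (hx.1 L),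
    fun L' L h => by simp [hx.2 L' L h]⟩

variable (p) in
/-- The functor `i*` (right adjoint to parabolic induction): the `U`-invariant and `M`-smooth vectors
in the roughening of `V`, where `M` acts by `m ↦ χ(m) m`. -/
def iStar [Fact (IsUnit (p : R))] (χ : G → Subring.center R) :
    Submodule R (CompactOpenProP p G → X.V) where
  carrier := {x | x ∈ rough p X ∧ (∀ g ∈ D.U, roughAct p X g x = x) ∧
    ∃ N : Subgroup G, IsOpen (N : Set G) ∧
      ∀ m ∈ D.M, m ∈ N → (χ m • roughAct p X m) x = x}
  add_mem' := by
    rintro x y ⟨hx, hxU, N, hN, hxN⟩ ⟨hy, hyU, N', hN', hyN⟩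
    refine ⟨add_mem hx hy, fun g hg => by rw [map_add, hxU g hg, hyU g hg], N ⊓ N', hN.inter hN',
      fun m hm hmN => by rw [map_add, hxN m hm hmN.1, hyN m hm hmN.2]⟩
  zero_mem' := ⟨zero_mem _, fun g _ => map_zero _, ⊤, isOpen_univ, fun m _ _ => map_zero _⟩
  smul_mem' := by
    rintro r x ⟨hx, hxU, N, hN, hxN⟩
    exact ⟨Submodule.smul_mem _ r hx, fun g hg => by rw [map_smul, hxU g hg], N, hN,
      fun m hm hmN => by rw [map_smul, hxN m hm hmN]⟩

variable (p) in
/-- The vectors in `i*(V)` that are invariant under `S ∩ M`. -/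
def iStarInv [Fact (IsUnit (p : R))] (χ : G → Subring.center R) (S : Subgroup G) :
    Submodule R (CompactOpenProP p G → X.V) :=
  D.iStar p X χ ⊓ ⨅ m : D.M, ⨅ _ : (m : G) ∈ S, LinearMap.ker (χ m • roughAct p X (m : G) - 1)

/-- The map on `S ∩ M`-invariants of `i*` induced by a homomorphism, given componentwise. -/
def iStarInvMap [Fact (IsUnit (p : R))] {X Y : SmoothRep.{u, v, w} R G} (f : X.Hom Y)
    (χ : G → Subring.center R) (S : Subgroup G) : D.iStarInv p X χ S →ₗ[R] D.iStarInv p Y χ S :=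
  (LinearMap.pi fun L => f.toLin ∘ₗ LinearMap.proj L :
    (CompactOpenProP p G → X.V) →ₗ[R] (CompactOpenProP p G → Y.V)).restrict fun x hx => by
    set φ : (CompactOpenProP p G → X.V) →ₗ[R] (CompactOpenProP p G → Y.V) :=
      LinearMap.pi fun L => f.toLin ∘ₗ LinearMap.proj L with hφ
    have hact : ∀ g : G, ∀ y, roughAct p Y g (φ y) = φ (roughAct p X g y) := fun g y =>
      funext fun L => (f.comm g _).symm
    have htw : ∀ g : G, ∀ y, (χ g • roughAct p X g) y = y →
        (χ g • roughAct p Y g) (φ y) = φ y := fun g y hy => by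
      rw [LinearMap.smul_apply, Subring.smul_def] at hy ⊢
      rw [hact, ← map_smul, hy]
    simp only [iStarInv, Submodule.mem_inf, Submodule.mem_iInf, LinearMap.mem_ker,
      LinearMap.sub_apply, sub_eq_zero] at hx ⊢
    obtain ⟨⟨⟨hxL, hxe⟩, hxU, N, hN, hxN⟩, hxS⟩ := hx
    refine ⟨⟨⟨fun L h hh => ?_, fun L' L hL => ?_⟩, fun g hg => ?_, N, hN,
      fun m hm hmN => htw m x (hxN m hm hmN)⟩, fun m hm => htw m x (hxS m hm)⟩
    · exact (f.comm h (x L)).symm.trans (congrArg f.toLin (hxL L h hh))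
    · exact (f.idem_comm L (x L')).symm.trans (congrArg f.toLin (hxe L' L hL))
    · rw [hact, hxU g hg]

/-- The natural map `i*(V) → r(V)` on the vectors invariant under `L ∩ M`, for `L` in good position:
it maps `x` to the class of `e_L x ∈ V^L`, which is the component of `x` at `L`. -/
def naturalMap (L : CompactOpenProP p G) : (CompactOpenProP p G → X.V) →ₗ[R] D.Jacquet X :=
  (D.coinvSub X).mkQ ∘ₗ LinearMap.proj L

end Adjoint

end LeviTriple

end

set_option linter.unusedSectionVars false

/-! Write `z` for the strictly positive element and `T = e_K z e_K`. An average depends only on the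
orbit over which it is taken. If `v` is fixed by `K ∩ U` and `K ∩ M`, the factorisation `K = (K ∩
Ubar)(K ∩ M)(K ∩ U)` shows that the `K`-orbit of `v` is its `(K ∩ Ubar)`-orbit, so a linear map that
is constant on this orbit takes the same value at `e_K v` and at `v` (`Decomposes.map_idem`). This
applies to `v = zⁿ y` with `y ∈ V^K`, because `z⁻ⁿ(K ∩ U)zⁿ ⊆ K` and `z` centralises `M`.

With the linear map `e_K z` this gives `Tⁿ y = e_K zⁿ y` (`hecke_pow_coe`), since `z(K ∩ Ubar)z⁻¹ ⊆
K`. With the projection to coinvariants it shows that `y ↦ [z⁻ⁿ y]` is compatible with `T`. The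
resulting map is injective because `e_K zᵐ` kills any given element of the coinvariant submodule for
large `m`. It is surjective because a `(K ∩ M)`-invariant smooth vector becomes `(K ∩ U)`-invariant
after applying a high power of `z`.

For an invariant element `x` of the roughening, passing from `x` at `zⁿKz⁻ⁿ` to `x_L` only involves
the factor `zⁿ(K ∩ Ubar)z⁻ⁿ`, which shrinks into any given `L`. Hence `x_L = e_L zⁿ yₙ` for large
`n`, where `yₙ = (z⁻ⁿ x)_K`; conversely, this formula builds `x` from a compatible sequence `y`.

The twist plays no role: the modulus is trivial on compact subgroups of `M`. Under the natural map,
the component of index `0` gives the class of `x_K`. It equals the class of `x_L` because averaging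
over one large compact subgroup of `Ubar` turns both vectors into the same component of `x`
(`naturalMap_eq`). -/

theorem mem_conj_smul_iff {G : Type u} [Group G] {g x : G} {S : Subgroup G} :
    x ∈ MulAut.conj g • S ↔ g⁻¹ * x * g ∈ S := by
  rw [Subgroup.mem_pointwise_smul_iff_inv_smul_mem, ← map_inv, MulAut.smul_def, MulAut.conj_apply,
    inv_inv]

/-! ### Compact open pro-`p` subgroups -/

namespace CompactOpenProP

variable {p : ℕ} {G : Type u} [Group G] [TopologicalSpace G]

@[ext]
theorem ext {L L' : CompactOpenProP p G} (h : L.toSubgroup = L'.toSubgroup) : L = L' := by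
  cases L; cases L'; cases h; rfl

theorem isCompact (L : CompactOpenProP p G) : IsCompact (L.toSubgroup : Set G) :=
  have := L.isProP.compact
  isCompact_iff_compactSpace.2 this

variable [IsTopologicalGroup G]

theorem mem_conj {g x : G} {L : CompactOpenProP p G} :
    x ∈ (L.conj g).toSubgroup ↔ g⁻¹ * x * g ∈ L.toSubgroup :=
  mem_conj_smul_iff (S := L.toSubgroup)

theorem conj_conj (g h : G) (L : CompactOpenProP p G) : (L.conj h).conj g = L.conj (g * h) := by
  ext x
  simp only [mem_conj]
  simp [mul_assoc]

theorem conj_one (L : CompactOpenProP p G) : L.conj 1 = L := by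
  ext x
  simp [mem_conj]

theorem conj_eq_of_normal {g : G} {L : CompactOpenProP p G}
    (h : ∀ x, g * x * g⁻¹ ∈ L.toSubgroup ↔ x ∈ L.toSubgroup) : L.conj g⁻¹ = L := by
  ext x
  simp [mem_conj, h]

theorem relIndex_ne_zero (L : CompactOpenProP p G) {N : Subgroup G} (hN : IsOpen (N : Set G)) :
    N.relIndex L.toSubgroup ≠ 0 :=
  (L.exists_index_eq (N.subgroupOf L.toSubgroup) (hN.preimage continuous_subtype_val)).1

/-- An open subgroup of a compact open pro-`p` subgroup. -/
def ofLE [hp : Fact p.Prime] (L : CompactOpenProP p G) (N : Subgroup G) (hN : IsOpen (N : Set G))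
    (h : N ≤ L.toSubgroup) : CompactOpenProP p G where
  toSubgroup := N
  isOpen := hN
  isProP := by
    refine ⟨isCompact_iff_compactSpace.1
      (L.isCompact.of_isClosed_subset (Subgroup.isClosed_of_isOpen N hN) h), ?_, fun S _ hS => ?_⟩
    · have := L.isProP.totallyDisconnected
      exact (Topology.IsEmbedding.inclusion (s := (N : Set G)) (t := (L.toSubgroup : Set G))
        h).isTotallyDisconnected_range.1 (isTotallyDisconnected_of_totallyDisconnectedSpace _)
    · have hSo : IsOpen ((S.map N.subtype : Subgroup G) : Set G) :=
        hN.isOpenEmbedding_subtypeVal.isOpenMap _ hS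
      obtain ⟨-, e, he⟩ := L.exists_index_eq ((S.map N.subtype).subgroupOf L.toSubgroup)
        (hSo.preimage continuous_subtype_val)
      -- The index of `S` in the big group is a multiple of its index in `N`, and it divides a power
      -- of `p` although `S` need not be normal there.
      have h1 : S.index ∣ (S.map N.subtype).relIndex L.toSubgroup := by
        have h2 : (S.map N.subtype).relIndex N = S.index := by
          rw [Subgroup.relIndex, Subgroup.subgroupOf, Subgroup.comap_map_eq_self_of_injective
            N.subtype_injective]
        rw [← h2, ← Subgroup.relIndex_mul_relIndex _ _ _ (Subgroup.map_subtype_le S) h]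
        exact Dvd.intro _ rfl
      exact ((Nat.dvd_prime_pow hp.out).1 (h1.trans he)).imp fun _ h => h.2

/-- Open normal subgroups of `L` are cofinal among the open subgroups. -/
theorem exists_normal [hp : Fact p.Prime] (L : CompactOpenProP p G) {N : Subgroup G}
    (hN : IsOpen (N : Set G)) : ∃ J : CompactOpenProP p G, J.toSubgroup ≤ L.toSubgroup ∧
      J.toSubgroup ≤ N ∧
      ∀ g ∈ L.toSubgroup, ∀ x, g * x * g⁻¹ ∈ J.toSubgroup ↔ x ∈ J.toSubgroup := by
  set S := N.subgroupOf L.toSubgroup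
  have hS : IsOpen (S : Set L.toSubgroup) := hN.preimage continuous_subtype_val
  have hfi : S.FiniteIndex := ⟨(L.exists_index_eq S hS).1⟩
  have hc : IsOpen (S.normalCore : Set L.toSubgroup) :=
    Subgroup.isOpen_of_isClosed_of_finiteIndex _
      (Subgroup.normalCore_isClosed S (Subgroup.isClosed_of_isOpen S hS))
  have hle := Subgroup.map_subtype_le S.normalCore
  refine ⟨L.ofLE (S.normalCore.map L.toSubgroup.subtype)
    (L.isOpen.isOpenEmbedding_subtypeVal.isOpenMap _ hc) hle, hle, ?_, ?_⟩
  · rintro _ ⟨x, hx, rfl⟩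
    exact S.normalCore_le hx
  · have key : ∀ g ∈ L.toSubgroup, ∀ x ∈ S.normalCore.map L.toSubgroup.subtype,
        g * x * g⁻¹ ∈ S.normalCore.map L.toSubgroup.subtype := by
      rintro g hg _ ⟨x, hx, rfl⟩
      exact ⟨_, (inferInstance : S.normalCore.Normal).conj_mem x hx ⟨g, hg⟩, rfl⟩
    intro g hg x
    refine ⟨fun h => ?_, key g hg x⟩
    rw [show x = g⁻¹ * (g * x * g⁻¹) * g⁻¹⁻¹ by group]
    exact key g⁻¹ (inv_mem hg) _ h

/-- If `J` is normalised by `H`, then `H J` is a subgroup. -/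
theorem exists_sup [hp : Fact p.Prime] (L J : CompactOpenProP p G) (hJ : J.toSubgroup ≤ L.toSubgroup)
    (hn : ∀ g ∈ L.toSubgroup, ∀ x, g * x * g⁻¹ ∈ J.toSubgroup ↔ x ∈ J.toSubgroup)
    {H : Subgroup G} (hH : H ≤ L.toSubgroup) : ∃ S : CompactOpenProP p G,
      ∀ x, x ∈ S.toSubgroup ↔ ∃ h ∈ H, ∃ j ∈ J.toSubgroup, x = h * j := by
  refine ⟨L.ofLE (H ⊔ J.toSubgroup) (Subgroup.isOpen_mono le_sup_right J.isOpen) (sup_le hH hJ),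
    fun x => ?_⟩
  change x ∈ H ⊔ J.toSubgroup ↔ _
  have hN : H ≤ Subgroup.normalizer (J.toSubgroup : Set G) := fun g hg =>
    Subgroup.mem_normalizer_iff.2 fun x => (hn g (hH hg) x).symm
  rw [← SetLike.mem_coe, Subgroup.coe_mul_of_left_le_normalizer_right _ _ hN, Set.mem_mul]
  simp [eq_comm]

end CompactOpenProP

/-! ### Averages over possibly non-open subgroups -/

namespace SmoothRep

variable {p : ℕ} {R : Type v} {G : Type u} [Ring R] [Group G] [TopologicalSpace G]
  (X : SmoothRep.{u, v, w} R G)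

theorem ρ_mul (g h : G) (x : X.V) : X.ρ (g * h) x = X.ρ g (X.ρ h x) := by
  rw [map_mul, Module.End.mul_apply]

theorem ρ_one (x : X.V) : X.ρ 1 x = x := by
  rw [map_one, Module.End.one_apply]

theorem ρ_injective (g : G) : Function.Injective (X.ρ g) := fun a b h => by
  simpa [← ρ_mul, ρ_one] using congrArg (X.ρ g⁻¹) h

theorem ρ_inv_mem_inv {g : G} {x : X.V} {H H' : Subgroup G} (hx : x ∈ X.inv H)
    (h : ∀ a ∈ H', g⁻¹ * a * g ∈ H) : X.ρ g x ∈ X.inv H' := fun a ha => by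
  have := hx _ (h a ha)
  rw [← ρ_mul, show a * g = g * (g⁻¹ * a * g) by group, ρ_mul, this]

theorem orbit_eq_singleton {H : Subgroup G} {x : X.V} (hx : x ∈ X.inv H) : X.orbit H x = {x} := by
  ext y
  refine ⟨?_, ?_⟩
  · rintro ⟨h, hh, rfl⟩
    exact hx h hh
  · rintro rfl
    exact ⟨1, H.one_mem, X.ρ_one _⟩

theorem average_of_mem_inv {H : Subgroup G} {x : X.V} (hx : x ∈ X.inv H) : X.average H x = x := by
  simp [average, X.orbit_eq_singleton hx]

variable {X} in
theorem average_eq_of_orbit_eq {H H' : Subgroup G} {x x' : X.V} (h : X.orbit H x = X.orbit H' x') :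
    X.average H x = X.average H' x' := by
  rw [average, average, h]

theorem orbit_ρ_eq_image (g : G) {H H' : Subgroup G} (h : ∀ a, a ∈ H' ↔ g⁻¹ * a * g ∈ H) (x : X.V) :
    X.orbit H' (X.ρ g x) = X.ρ g '' X.orbit H x := by
  ext y
  simp only [orbit, Set.mem_image, SetLike.mem_coe, exists_exists_and_eq_and]
  constructor
  · rintro ⟨a, ha, rfl⟩
    exact ⟨_, (h a).1 ha, by simp only [← ρ_mul]; group⟩
  · rintro ⟨a, ha, rfl⟩
    refine ⟨g * a * g⁻¹, (h _).2 (by simpa [mul_assoc] using ha), ?_⟩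
    simp only [← ρ_mul]; group

theorem ρ_average (g : G) {H H' : Subgroup G} (h : ∀ a, a ∈ H' ↔ g⁻¹ * a * g ∈ H) (x : X.V) :
    X.ρ g (X.average H x) = X.average H' (X.ρ g x) := by
  -- An additive equivalence commutes with `finsum` without any finiteness condition on the orbit.
  let E : X.V ≃+ X.V :=
    { toFun := X.ρ g, invFun := X.ρ g⁻¹, map_add' := map_add _,
      left_inv := fun x => by simp,
      right_inv := fun x => by simp }
  rw [average, average, X.orbit_ρ_eq_image g h, Set.ncard_image_of_injective _ (X.ρ_injective g),
    map_smul, finsum_mem_image (X.ρ_injective g).injOn]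
  congr 1
  have := E.map_finsum fun y => ∑ᶠ _ : y ∈ X.orbit H x, y
  refine this.trans (finsum_congr fun y => E.map_finsum _)

variable [IsTopologicalGroup G]

section Idempotent

variable [Fact (IsUnit (p : R))]

theorem idem_apply (L : CompactOpenProP p G) (x : X.V) : X.idem L x = X.average L.toSubgroup x := rfl

theorem idem_ρ (L : CompactOpenProP p G) {g : G} (hg : g ∈ L.toSubgroup) (x : X.V) :
    X.idem L (X.ρ g x) = X.idem L x := by
  refine average_eq_of_orbit_eq (Set.ext fun y => ⟨?_, ?_⟩)
  · rintro ⟨h, hh, rfl⟩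
    exact ⟨h * g, mul_mem hh hg, X.ρ_mul _ _ _⟩
  · rintro ⟨h, hh, rfl⟩
    refine ⟨h * g⁻¹, mul_mem hh (inv_mem hg), ?_⟩
    simp only [← ρ_mul, inv_mul_cancel_right]

theorem idem_of_mem_inv {L : CompactOpenProP p G} {x : X.V} (hx : x ∈ X.inv L.toSubgroup) :
    X.idem L x = x :=
  X.average_of_mem_inv hx

theorem ρ_idem (g : G) (L : CompactOpenProP p G) (x : X.V) :
    X.ρ g (X.idem L x) = X.idem (L.conj g) (X.ρ g x) :=
  X.ρ_average g (fun _ => CompactOpenProP.mem_conj) x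

end Idempotent

variable [hp : Fact p.Prime]

/-- The average over an arbitrary subgroup of `L` of a given vector is the average over an open one. -/
theorem exists_open_orbit_eq (L : CompactOpenProP p G) {H : Subgroup G} (hH : H ≤ L.toSubgroup)
    (x : X.V) : ∃ S : CompactOpenProP p G, H ≤ S.toSubgroup ∧ X.orbit S.toSubgroup x = X.orbit H x ∧
      ∀ a ∈ S.toSubgroup, ∃ h ∈ H, X.ρ a x = X.ρ h x := by
  obtain ⟨N, hN, hNx⟩ := X.smooth x
  -- `J` fixes `x` and is normalised by `H`, so `H J` is an open group with the same orbit through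
  -- `x` as `H`.
  obtain ⟨J, hJL, hJN, hJ⟩ := L.exists_normal hN
  obtain ⟨S, hS⟩ := L.exists_sup J hJL hJ hH
  have key : ∀ a ∈ S.toSubgroup, ∃ h ∈ H, X.ρ a x = X.ρ h x := by
    intro a ha
    obtain ⟨h, hh, j, hj, rfl⟩ := (hS a).1 ha
    exact ⟨h, hh, by rw [ρ_mul, hNx j (hJN hj)]⟩
  have hHS : H ≤ S.toSubgroup := fun h hh => (hS h).2 ⟨h, hh, 1, J.toSubgroup.one_mem, by simp⟩
  refine ⟨S, hHS, Set.Subset.antisymm ?_ (Set.image_mono hHS), key⟩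
  rintro _ ⟨a, ha, rfl⟩
  obtain ⟨h, hh, e⟩ := key a ha
  exact ⟨h, hh, e.symm⟩

variable [Fact (IsUnit (p : R))]

theorem average_mem_inv (L : CompactOpenProP p G) {H : Subgroup G} (hH : H ≤ L.toSubgroup) (x : X.V) :
    X.average H x ∈ X.inv H := by
  obtain ⟨S, hHS, ho, -⟩ := X.exists_open_orbit_eq L hH x
  rw [← average_eq_of_orbit_eq ho, ← X.idem_apply]
  exact fun h hh => X.idem_mem_inv S x h (hHS hh)

/-- The average becomes a sum of equal terms divided by their number, which divides a power of `p`
and so is a unit in `R`. Passing to an open group with the same orbit makes this available for `H =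
L ∩ Ubar` and `H = L ∩ M`. -/
theorem map_average {W : Type*} [AddCommGroup W] [Module R W] (f : X.V →ₗ[R] W)
    (L : CompactOpenProP p G) {H : Subgroup G} (hH : H ≤ L.toSubgroup) (x : X.V)
    (hf : ∀ h ∈ H, f (X.ρ h x) = f x) : f (X.average H x) = f x := by
  obtain ⟨S, hHS, ho, hk⟩ := X.exists_open_orbit_eq L hH x
  have hst := X.isOpen_stab S.toSubgroup x
  obtain ⟨hne, e, he⟩ := S.exists_index_eq _ hst
  have hfi : (X.stab S.toSubgroup x).FiniteIndex := ⟨hne⟩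
  have : Fintype (S.toSubgroup ⧸ X.stab S.toSubgroup x) := Fintype.ofFinite _
  have hfx : ∀ a ∈ S.toSubgroup, f (X.ρ a x) = f x := fun a ha => by
    obtain ⟨h, hh, e⟩ := hk a ha
    rw [e, hf h hh]
  rw [← average_eq_of_orbit_eq ho, X.average_eq S _ hst x fun g hg => hg, map_smul,
    finsum_eq_sum_of_fintype, map_sum, Finset.sum_congr rfl fun q _ => hfx _ q.out.2,
    Finset.sum_const, Finset.card_univ, ← Nat.card_eq_fintype_card, ← Subgroup.index_eq_card,
    ← Nat.cast_smul_eq_nsmul R, smul_smul, Ring.inverse_mul_cancel _ (isUnit_of_dvd he), one_smul]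

theorem idem_average (L : CompactOpenProP p G) {H : Subgroup G} (hH : H ≤ L.toSubgroup) (x : X.V) :
    X.idem L (X.average H x) = X.idem L x :=
  X.map_average _ L hH x fun _ hh => X.idem_ρ L (hH hh) x

theorem idem_idem {L L' : CompactOpenProP p G} (h : L'.toSubgroup ≤ L.toSubgroup) (x : X.V) :
    X.idem L (X.idem L' x) = X.idem L x :=
  X.idem_average L h x

end SmoothRep

/-! ### Contraction and exhaustion by conjugation -/

section Contraction

variable {G : Type u} [Group G] {S : Subgroup G} {a : G}

theorem conj_pow_mem (h : S ≤ MulAut.conj a • S) {i j : ℕ} (hij : i ≤ j) {x : G}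
    (hx : (a ^ i)⁻¹ * x * a ^ i ∈ S) : (a ^ j)⁻¹ * x * a ^ j ∈ S := by
  induction j, hij using Nat.le_induction with
  | base => exact hx
  | succ j _ ih =>
    have := mem_conj_smul_iff.1 (h ih)
    rwa [show a⁻¹ * ((a ^ j)⁻¹ * x * a ^ j) * a = (a ^ (j + 1))⁻¹ * x * a ^ (j + 1) by
      rw [pow_succ]; group] at this

theorem exists_conj_pow_mem {B : Subgroup G} (h : S ≤ MulAut.conj a • S)
    (hB : ⋃ n : ℕ, ((MulAut.conj (a ^ n) • S : Subgroup G) : Set G) = B) {x : G} (hx : x ∈ B) :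
    ∃ n : ℕ, ∀ m ≥ n, (a ^ m)⁻¹ * x * a ^ m ∈ S := by
  rw [← SetLike.mem_coe, ← hB, Set.mem_iUnion] at hx
  obtain ⟨n, hn⟩ := hx
  exact ⟨n, fun m hm => conj_pow_mem h hm (mem_conj_smul_iff.1 hn)⟩

variable [TopologicalSpace G] [IsTopologicalGroup G]

/-- The conjugates `a⁻ⁿ S aⁿ` form a decreasing sequence of compact sets with intersection `1`, so
one of them lies in the neighbourhood `N` of `1`. -/
theorem exists_conj_pow_mem_of_isOpen (hc : IsCompact (S : Set G)) (hcl : IsClosed (S : Set G))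
    (h : S ≤ MulAut.conj a • S) (hinf : ⨅ n : ℕ, (MulAut.conj (a ^ n)⁻¹ • S : Subgroup G) = ⊥)
    {N : Subgroup G} (hN : IsOpen (N : Set G)) :
    ∃ n : ℕ, ∀ m ≥ n, ∀ x ∈ S, (a ^ m)⁻¹ * x * a ^ m ∈ N := by
  have hmem : ∀ (n : ℕ) (x : G), x ∈ (MulAut.conj (a ^ n)⁻¹ • S : Subgroup G) ↔
      a ^ n * x * (a ^ n)⁻¹ ∈ S := fun n x => by rw [mem_conj_smul_iff, inv_inv]
  have hanti : Antitone fun n : ℕ => (MulAut.conj (a ^ n)⁻¹ • S : Subgroup G) := by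
    intro i j hij x hx
    rw [hmem] at hx ⊢
    have := conj_pow_mem h (Nat.zero_le (j - i)) (x := a ^ j * x * (a ^ j)⁻¹) (by simpa using hx)
    obtain ⟨k, rfl⟩ := Nat.exists_eq_add_of_le hij
    rw [Nat.add_sub_cancel_left, add_comm i k, pow_add] at this
    simpa [mul_assoc] using this
  have himg : ∀ n : ℕ, ((MulAut.conj (a ^ n)⁻¹ • S : Subgroup G) : Set G) =
      (Homeomorph.mulRight (a ^ n)) '' ((Homeomorph.mulLeft (a ^ n)⁻¹) '' S) := by
    intro n
    ext x
    simp only [SetLike.mem_coe, hmem, Set.mem_image, exists_exists_and_eq_and,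
      Homeomorph.coe_mulLeft, Homeomorph.coe_mulRight]
    refine ⟨fun hx => ⟨_, hx, by group⟩, ?_⟩
    rintro ⟨y, hy, rfl⟩
    simpa [mul_assoc] using hy
  obtain ⟨n, hn⟩ := exists_subset_nhds_of_isCompact'
    (V := fun n : ℕ => ((MulAut.conj (a ^ n)⁻¹ • S : Subgroup G) : Set G)) (U := (N : Set G))
    (fun i j => ⟨max i j, hanti (le_max_left i j), hanti (le_max_right i j)⟩)
    (fun n => by
      rw [himg]
      exact (hc.image (Homeomorph.continuous _)).image (Homeomorph.continuous _))
    (fun n => by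
      rw [himg]
      exact (Homeomorph.isClosed_image _).2 ((Homeomorph.isClosed_image _).2 hcl))
    (fun x hx => by
      rw [← Subgroup.coe_iInf, hinf] at hx
      rw [Subgroup.mem_bot.1 hx]
      exact hN.mem_nhds N.one_mem)
  refine ⟨n, fun m hm x hx => hn (hanti hm ?_)⟩
  change _ ∈ (MulAut.conj (a ^ m)⁻¹ • S : Subgroup G)
  rw [hmem]
  simpa [mul_assoc] using hx

/-- The conditions `a⁻ⁿ x aⁿ ∈ K` define open sets that cover `C` and increase on `B`, so a finite
subcover gives one exponent for all of `C`. -/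
theorem exists_conj_pow_mem_of_isCompact {K B : Subgroup G} (hK : IsOpen (K : Set G))
    (h : K ⊓ B ≤ MulAut.conj a • (K ⊓ B))
    (hB : ⋃ n : ℕ, ((MulAut.conj (a ^ n) • (K ⊓ B) : Subgroup G) : Set G) = B)
    (hconj : ∀ n : ℕ, ∀ x ∈ B, (a ^ n)⁻¹ * x * a ^ n ∈ B)
    {C : Set G} (hC : IsCompact C) (hCB : C ⊆ B) :
    ∃ n : ℕ, ∀ m ≥ n, ∀ x ∈ C, (a ^ m)⁻¹ * x * a ^ m ∈ K := by
  obtain ⟨t, ht⟩ := hC.elim_finite_subcover (fun n : ℕ => (fun x => (a ^ n)⁻¹ * x * a ^ n) ⁻¹' (K : Set G))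
    (fun n => hK.preimage (by fun_prop)) (fun x hx => by
      obtain ⟨n, hn⟩ := exists_conj_pow_mem h hB (hCB hx)
      exact Set.mem_iUnion.2 ⟨n, (hn n le_rfl).1⟩)
  refine ⟨t.sup id, fun m hm x hx => ?_⟩
  obtain ⟨n, hnt, hn⟩ := Set.mem_iUnion₂.1 (ht hx)
  exact (conj_pow_mem h ((Finset.le_sup (f := id) hnt).trans hm) ⟨hn, hconj n x (hCB hx)⟩).1

end Contraction

/-! ### The modulus on compact subgroups -/

section Modulus

variable {G : Type u} [Group G]

/-- Conjugation by `m` preserves the commensurable group `C'`, hence preserves volume. In terms of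
indices: `C` and its conjugate meet `C'` with equal index, and both are compared through the triple
intersection. -/
theorem relIndex_conj_eq {C C' : Subgroup G} {m : G} (hm : MulAut.conj m • C' = C')
    (h : C.relIndex C' ≠ 0) (h' : C'.relIndex C ≠ 0) :
    C.relIndex (MulAut.conj m • C) = (MulAut.conj m • C).relIndex C := by
  set C2 := MulAut.conj m • C with hC2
  have e1 : C2.relIndex C' = C.relIndex C' := by
    conv_lhs => rw [← hm, hC2, Subgroup.relIndex_pointwise_smul]
  have e2 : C'.relIndex C2 = C'.relIndex C := by
    conv_lhs => rw [← hm, hC2, Subgroup.relIndex_pointwise_smul]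
  have r1 : C.relIndex (C2 ⊓ C') = C2.relIndex (C ⊓ C') := by
    have a := Subgroup.relIndex_inf_mul_relIndex C C2 C'
    rw [inf_comm C C2, ← Subgroup.relIndex_inf_mul_relIndex C2 C C', e1] at a
    exact Nat.eq_of_mul_eq_mul_right (Nat.pos_of_ne_zero h) a
  have a1 := Subgroup.relIndex_inf_mul_relIndex C' C2 C
  have a2 := Subgroup.relIndex_inf_mul_relIndex C' C C2
  rw [inf_comm C' C2, ← Subgroup.relIndex_inf_mul_relIndex C2 C' C, inf_comm C' C, ← r1] at a1
  rw [inf_comm C' C, ← Subgroup.relIndex_inf_mul_relIndex C C' C2, e2, inf_comm C' C2] at a2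
  rw [inf_comm C2 C, ← a2] at a1
  have hne : C'.relIndex (C ⊓ C2) ≠ 0 := fun h0 =>
    h' (Subgroup.relIndex_eq_zero_of_le_right inf_le_left h0)
  exact (Nat.eq_of_mul_eq_mul_left (Nat.pos_of_ne_zero hne) a1).symm

theorem modularTwist_eq_one {p : ℕ} {R : Type v} [Ring R] (s : (Subring.center R)ˣ)
    {C C' : Subgroup G} {m : G} (hm : MulAut.conj m • C' = C')
    (h : C.relIndex C' ≠ 0) (h' : C'.relIndex C ≠ 0) : modularTwist p s C m = 1 := by
  rw [modularTwist, modulusExponent, relIndex_conj_eq hm h h', sub_self, zpow_zero, Units.val_one]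

end Modulus

/-! ### Factorisations and strictly positive elements -/

namespace LeviTriple

variable {G : Type u} [Group G] (D : LeviTriple G)

theorem conj_Ubar_mem_iff {m x : G} (hm : m ∈ D.M) : m * x * m⁻¹ ∈ D.Ubar ↔ x ∈ D.Ubar := by
  refine ⟨fun h => ?_, D.conj_Ubar m hm x⟩
  simpa [mul_assoc] using D.conj_Ubar m⁻¹ (inv_mem hm) _ h

/-- Every element of `K` is a product of elements of `K ∩ Ubar`, `K ∩ M` and `K ∩ U`. -/
def Decomposes (K : Subgroup G) : Prop :=
  ∀ x ∈ K, ∃ a ∈ K ⊓ D.Ubar, ∃ b ∈ K ⊓ D.M, ∃ c ∈ K ⊓ D.U, x = a * b * c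

variable {D}

/-- Only surjectivity for this one ordering is needed: the factor in `U` acts on a vector first,
then the one in `M`, and only the one in `Ubar` remains. This weaker property also passes easily to
conjugates by `M`. -/
theorem IsInGoodPosition.decomposes {K : Subgroup G} (h : D.IsInGoodPosition K) :
    D.Decomposes K := fun x hx => by
  obtain ⟨⟨a, b, c⟩, ⟨ha, hb, hc⟩, rfl⟩ := h.2.2.2.2.2.surjOn hx
  exact ⟨a, ha, b, hb, c, hc, rfl⟩

variable {p : ℕ} [TopologicalSpace G] [IsTopologicalGroup G]

theorem Decomposes.conj {K : CompactOpenProP p G} (h : D.Decomposes K.toSubgroup) {m : G}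
    (hm : m ∈ D.M) : D.Decomposes (K.conj m).toSubgroup := fun x hx => by
  obtain ⟨a, ha, b, hb, c, hc, e⟩ := h _ (CompactOpenProP.mem_conj.1 hx)
  have hK : ∀ y ∈ K.toSubgroup, m * y * m⁻¹ ∈ (K.conj m).toSubgroup := fun y hy =>
    CompactOpenProP.mem_conj.2 (by simpa [mul_assoc] using hy)
  refine ⟨_, ⟨hK a ha.1, D.conj_Ubar m hm a ha.2⟩, _, ⟨hK b hb.1, D.M.mul_mem (D.M.mul_mem hm hb.2)
    (D.M.inv_mem hm)⟩, _, ⟨hK c hc.1, D.conj_U m hm c hc.2⟩, ?_⟩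
  rw [show x = m * (m⁻¹ * x * m) * m⁻¹ by group, e]
  group

/-- The modular twist is trivial on compact subgroups of `M`. -/
theorem modularTwist_eq_one_of_mem {R : Type v} [Ring R] (s : (Subring.center R)ˣ)
    (K L : CompactOpenProP p G) {m : G} (hm : m ∈ D.M) (hmL : m ∈ L.toSubgroup) :
    modularTwist p s (K.toSubgroup ⊓ D.Ubar) m = 1 := by
  have key : ∀ A B : CompactOpenProP p G,
      (A.toSubgroup ⊓ D.Ubar).relIndex (B.toSubgroup ⊓ D.Ubar) ≠ 0 := fun A B =>
    Subgroup.relIndex_inter_ne_zero (B.relIndex_ne_zero A.isOpen) D.Ubar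
  -- `L ∩ Ubar` is normalised by `m` and commensurable with `K ∩ Ubar`.
  refine modularTwist_eq_one s (C' := L.toSubgroup ⊓ D.Ubar) ?_ (key _ _) (key _ _)
  ext x
  rw [mem_conj_smul_iff, Subgroup.mem_inf, Subgroup.mem_inf]
  have h1 := D.conj_Ubar_mem_iff (inv_mem hm) (x := x)
  rw [inv_inv] at h1
  rw [h1, Subgroup.mul_mem_cancel_right _ hmL, Subgroup.mul_mem_cancel_left _ (inv_mem hmL)]

/-- Basic properties of strictly positive elements. -/
structure IsContracting (D : LeviTriple G) (K : CompactOpenProP p G) (z : G) : Prop where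
  pow_mem : ∀ n : ℕ, z ^ n ∈ D.M
  comm : ∀ n : ℕ, ∀ m ∈ D.M, z ^ n * m = m * z ^ n
  U_pow : ∀ n : ℕ, ∀ x ∈ K.toSubgroup, x ∈ D.U → (z ^ n)⁻¹ * x * z ^ n ∈ K.toSubgroup
  Ubar_pow : ∀ n : ℕ, ∀ x ∈ K.toSubgroup, x ∈ D.Ubar → z ^ n * x * (z ^ n)⁻¹ ∈ K.toSubgroup
  U_exhaust : ∀ x ∈ D.U, ∃ n : ℕ, ∀ m ≥ n, (z ^ m)⁻¹ * x * z ^ m ∈ K.toSubgroup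
  Ubar_exhaust : ∀ C : Set G, IsCompact C → C ⊆ D.Ubar →
    ∃ n : ℕ, ∀ m ≥ n, ∀ x ∈ C, z ^ m * x * (z ^ m)⁻¹ ∈ K.toSubgroup
  U_contract : ∀ N : Subgroup G, IsOpen (N : Set G) →
    ∃ n : ℕ, ∀ m ≥ n, ∀ x ∈ K.toSubgroup, x ∈ D.U → (z ^ m)⁻¹ * x * z ^ m ∈ N
  Ubar_contract : ∀ N : Subgroup G, IsOpen (N : Set G) →
    ∃ n : ℕ, ∀ m ≥ n, ∀ x ∈ K.toSubgroup, x ∈ D.Ubar → z ^ m * x * (z ^ m)⁻¹ ∈ N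

theorem IsStrictlyPositive.isContracting {K : CompactOpenProP p G} {z : G}
    (hU : IsClosed (D.U : Set G)) (hUbar : IsClosed (D.Ubar : Set G))
    (hz : D.IsStrictlyPositive K.toSubgroup z) : D.IsContracting K z := by
  obtain ⟨⟨z', hz'⟩, hzc, rfl⟩ := hz.mem_center
  set z : G := D.M.subtype ⟨z', hz'⟩ with hzdef
  have hM : ∀ n : ℕ, z ^ n ∈ D.M := fun n => pow_mem hz' n
  have hcomm : ∀ m ∈ D.M, z * m = m * z := fun m hm =>
    (congrArg Subtype.val (Subgroup.mem_center_iff.1 hzc ⟨m, hm⟩)).symm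
  have hKc : IsClosed (K.toSubgroup : Set G) := Subgroup.isClosed_of_isOpen _ K.isOpen
  -- The statements about `Ubar` come from the general contraction lemmas for `a = z⁻¹`, those about
  -- `U` from `a = z`.
  have hinv : ∀ n : ℕ, ∀ x, z ^ n * x * (z ^ n)⁻¹ = (z⁻¹ ^ n)⁻¹ * x * z⁻¹ ^ n := fun n x => by
    rw [inv_pow, inv_inv]
  have hUn : ⋃ n : ℕ, ((MulAut.conj (z⁻¹ ^ n) • (K.toSubgroup ⊓ D.Ubar) : Subgroup G) : Set G) =
      D.Ubar := by simpa only [inv_pow] using hz.Ubar_iUnion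
  have hIn : ⨅ n : ℕ, (MulAut.conj (z⁻¹ ^ n)⁻¹ • (K.toSubgroup ⊓ D.Ubar) : Subgroup G) = ⊥ := by
    simpa only [inv_pow, inv_inv] using hz.Ubar_iInf
  have hconj : ∀ n : ℕ, ∀ x ∈ D.Ubar, (z⁻¹ ^ n)⁻¹ * x * z⁻¹ ^ n ∈ D.Ubar := fun n x hx => by
    rw [← hinv]
    exact D.conj_Ubar _ (hM n) x hx
  refine ⟨hM, fun n m hm => ?_, fun n x hxK hx => ?_, fun n x hxK hx => ?_, fun x hx => ?_,
    fun C hC hCU => ?_, fun N hN => ?_, fun N hN => ?_⟩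
  · exact (Commute.pow_left (hcomm m hm) n).eq
  · exact (conj_pow_mem hz.U_le n.zero_le (x := x) (by simpa using ⟨hxK, hx⟩)).1
  · rw [hinv]
    exact (conj_pow_mem hz.Ubar_le n.zero_le (x := x) (by simpa using ⟨hxK, hx⟩)).1
  · obtain ⟨n, hn⟩ := exists_conj_pow_mem hz.U_le hz.U_iUnion hx
    exact ⟨n, fun m hm => (hn m hm).1⟩
  · simp only [hinv]
    exact exists_conj_pow_mem_of_isCompact K.isOpen hz.Ubar_le hUn hconj hC hCU
  · obtain ⟨n, hn⟩ := exists_conj_pow_mem_of_isOpen (K.isCompact.inter_right hU) (hKc.inter hU)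
      hz.U_le hz.U_iInf hN
    exact ⟨n, fun m hm x hxK hx => hn m hm x ⟨hxK, hx⟩⟩
  · obtain ⟨n, hn⟩ := exists_conj_pow_mem_of_isOpen (K.isCompact.inter_right hUbar)
      (hKc.inter hUbar) hz.Ubar_le hIn hN
    simp only [hinv]
    exact ⟨n, fun m hm x hxK hx => hn m hm x ⟨hxK, hx⟩⟩

end LeviTriple

noncomputable section

namespace LeviTriple

variable {p : ℕ} {R : Type v} {G : Type u} [Ring R] [Group G] [TopologicalSpace G]
  [IsTopologicalGroup G] [hp : Fact p.Prime] [Fact (IsUnit (p : R))] {D : LeviTriple G}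
  (X : SmoothRep.{u, v, w} R G) {K : CompactOpenProP p G} {z : G}

/-! ### Powers of the Hecke operator -/

section Hecke

/-- If `v` is invariant under `L ∩ U` and `L ∩ M`, then averaging `v` over `L` amounts to averaging
over `L ∩ Ubar`. -/
theorem Decomposes.idem_eq_average {L : CompactOpenProP p G} (hL : D.Decomposes L.toSubgroup)
    {v : X.V} (hU : v ∈ X.inv (L.toSubgroup ⊓ D.U)) (hM : v ∈ X.inv (L.toSubgroup ⊓ D.M)) :
    X.idem L v = X.average (L.toSubgroup ⊓ D.Ubar) v := by
  refine SmoothRep.average_eq_of_orbit_eq (Set.Subset.antisymm ?_ (Set.image_mono inf_le_left))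
  rintro _ ⟨x, hx, rfl⟩
  obtain ⟨a, ha, b, hb, c, hc, rfl⟩ := hL x hx
  exact ⟨a, ha, by simp only [SmoothRep.ρ_mul, hU c hc, hM b hb]⟩

/-- Removes an idempotent `e_L` under a linear map that does not see the action of `L ∩ Ubar`:
either a further idempotent that absorbs it, or the projection to coinvariants. -/
theorem Decomposes.map_idem {L : CompactOpenProP p G} (hL : D.Decomposes L.toSubgroup)
    {v : X.V} (hU : v ∈ X.inv (L.toSubgroup ⊓ D.U)) (hM : v ∈ X.inv (L.toSubgroup ⊓ D.M))
    {W : Type*} [AddCommGroup W] [Module R W] (f : X.V →ₗ[R] W)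
    (hf : ∀ h ∈ L.toSubgroup, h ∈ D.Ubar → f (X.ρ h v) = f v) : f (X.idem L v) = f v := by
  rw [hL.idem_eq_average X hU hM]
  exact X.map_average f L inf_le_left v fun h hh => hf h hh.1 hh.2

theorem mkQ_ρ {g : G} (hg : g ∈ D.Ubar) (v : X.V) :
    (D.coinvSub X).mkQ (X.ρ g v) = (D.coinvSub X).mkQ v := by
  rw [← sub_eq_zero, ← map_sub]
  exact (Submodule.Quotient.mk_eq_zero _).2 (Submodule.subset_span ⟨g, hg, v, rfl⟩)

variable (hK : D.Decomposes K.toSubgroup) (hz : D.IsContracting K z)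

theorem hecke_coe (y : X.inv K.toSubgroup) :
    ((X.hecke K z y : X.inv K.toSubgroup) : X.V) = X.idem K (X.ρ z y) :=
  congrArg (fun v => X.idem K (X.ρ z v)) (X.idem_of_mem_inv y.2)

include hz in
theorem IsContracting.ρ_pow_mem_inv_U (n : ℕ) {y : X.V} (hy : y ∈ X.inv K.toSubgroup) :
    X.ρ (z ^ n) y ∈ X.inv (K.toSubgroup ⊓ D.U) :=
  X.ρ_inv_mem_inv hy fun a ha => hz.U_pow n a ha.1 ha.2

include hz in
theorem IsContracting.conj_M (n : ℕ) {m : G} (hm : m ∈ D.M) : (z ^ n)⁻¹ * m * z ^ n = m := by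
  rw [mul_assoc, ← hz.comm n m hm, inv_mul_cancel_left]

include hz in
theorem IsContracting.conj_M' (n : ℕ) {m : G} (hm : m ∈ D.M) : z ^ n * m * (z ^ n)⁻¹ = m := by
  rw [hz.comm n m hm, mul_inv_cancel_right]

include hz in
theorem IsContracting.ρ_pow_mem_inv_M (n : ℕ) {y : X.V} (hy : y ∈ X.inv (K.toSubgroup ⊓ D.M)) :
    X.ρ (z ^ n) y ∈ X.inv (K.toSubgroup ⊓ D.M) :=
  X.ρ_inv_mem_inv hy fun a ha => by rwa [hz.conj_M n ha.2]

theorem inv_mono {H H' : Subgroup G} (h : H ≤ H') : X.inv H' ≤ X.inv H :=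
  fun _ hx g hg => hx g (h hg)

include hK hz in
-- In `e_K z e_K zⁿ y` the inner `e_K` is an average over `K ∩ Ubar`; moved past `z`, it lands in
-- `K` and is absorbed by the outer `e_K`.
theorem hecke_pow_coe (n : ℕ) (y : X.inv K.toSubgroup) :
    (((X.hecke K z ^ n) y : X.inv K.toSubgroup) : X.V) = X.idem K (X.ρ (z ^ n) y) := by
  induction n with
  | zero => simpa using (X.idem_of_mem_inv y.2).symm
  | succ n ih =>
    rw [pow_succ', Module.End.mul_apply, hecke_coe, ih, pow_succ', X.ρ_mul]
    refine hK.map_idem X (hz.ρ_pow_mem_inv_U X n y.2)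
      (hz.ρ_pow_mem_inv_M X n (inv_mono X inf_le_left y.2)) (X.idem K ∘ₗ X.ρ z) fun h hh hU => ?_
    have := hz.Ubar_pow 1 h hh hU
    rw [pow_one] at this
    change X.idem K (X.ρ z (X.ρ h _)) = X.idem K (X.ρ z _)
    rw [← X.idem_ρ K this (X.ρ z (X.ρ (z ^ n) y))]
    simp only [← X.ρ_mul, inv_mul_cancel_right, ← mul_assoc]

include hK hz in
-- The idempotent averages only over `K ∩ Ubar`, and `z⁻ⁿ` carries this into `Ubar`, which acts
-- trivially on coinvariants.
theorem mkQ_ρ_idem (n : ℕ) {v : X.V} (hU : v ∈ X.inv (K.toSubgroup ⊓ D.U))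
    (hM : v ∈ X.inv (K.toSubgroup ⊓ D.M)) :
    (D.coinvSub X).mkQ (X.ρ (z ^ n)⁻¹ (X.idem K v)) = (D.coinvSub X).mkQ (X.ρ (z ^ n)⁻¹ v) := by
  refine hK.map_idem X hU hM ((D.coinvSub X).mkQ ∘ₗ X.ρ (z ^ n)⁻¹) fun h _ hU => ?_
  change (D.coinvSub X).mkQ (X.ρ _ (X.ρ h v)) = (D.coinvSub X).mkQ (X.ρ _ v)
  have := D.conj_Ubar _ (inv_mem (hz.pow_mem n)) h hU
  rw [← mkQ_ρ X this (X.ρ _ v)]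
  simp only [← X.ρ_mul, inv_mul_cancel_right]

include hz in
/-- A vector that vanishes in the Jacquet module is killed by `e_K zᵐ` for large `m`. -/
theorem exists_idem_ρ_pow_eq_zero {v : X.V} (hv : v ∈ D.coinvSub X) :
    ∃ n : ℕ, ∀ m ≥ n, X.idem K (X.ρ (z ^ m) v) = 0 := by
  induction hv using Submodule.span_induction with
  | mem x hx =>
    obtain ⟨g, hg, x, rfl⟩ := hx
    obtain ⟨n, hn⟩ := hz.Ubar_exhaust {g} isCompact_singleton (by simpa using hg)
    refine ⟨n, fun m hm => ?_⟩
    rw [map_sub, map_sub, sub_eq_zero, ← X.idem_ρ K (hn m hm g rfl) (X.ρ (z ^ m) x)]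
    simp only [← X.ρ_mul, inv_mul_cancel_right]
  | zero => exact ⟨0, fun m _ => by simp⟩
  | add x y _ _ hx hy =>
    obtain ⟨a, ha⟩ := hx
    obtain ⟨b, hb⟩ := hy
    refine ⟨max a b, fun m hm => ?_⟩
    rw [map_add, map_add, ha m (le_of_max_le_left hm), hb m (le_of_max_le_right hm), add_zero]
  | smul r x _ hx =>
    obtain ⟨a, ha⟩ := hx
    exact ⟨a, fun m hm => by rw [map_smul, map_smul, ha m hm, smul_zero]⟩

end Hecke

/-! ### The Jacquet module as an inductive limit -/

section Inductive

variable {χ : G → Subring.center R}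

theorem mem_jacquetInv_iff {S : Subgroup G} (hχ : ∀ m ∈ D.M, m ∈ S → χ m = 1) {q : D.Jacquet X} :
    q ∈ D.jacquetInv X χ S ↔ ∀ m : D.M, (m : G) ∈ S → D.jacquetAct X m q = q := by
  simp only [jacquetInv, Submodule.mem_iInf, LinearMap.mem_ker, LinearMap.sub_apply, sub_eq_zero,
    LinearMap.smul_apply, Module.End.one_apply]
  refine forall₂_congr fun m hm => ?_
  rw [hχ m m.2 hm, one_smul]

variable (hK : D.Decomposes K.toSubgroup) (hz : D.IsContracting K z)
  (hχ : ∀ m ∈ D.M, m ∈ K.toSubgroup → χ m = 1)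

/-- The map from the inductive limit to the Jacquet module that sends `y` in the `n`-th copy of
`V^K` to the class of `z⁻ⁿ y`. -/
def indToJacquet : IndLim (X.hecke K z) →ₗ[R] D.Jacquet X :=
  Module.DirectLimit.lift R ℕ _ _
    (fun n => (D.coinvSub X).mkQ ∘ₗ X.ρ (z ^ n)⁻¹ ∘ₗ (X.inv K.toSubgroup).subtype)
    fun i j hij y => by
      change (D.coinvSub X).mkQ (X.ρ (z ^ j)⁻¹ ((X.hecke K z ^ (j - i)) y : X.inv K.toSubgroup)) =
        (D.coinvSub X).mkQ (X.ρ (z ^ i)⁻¹ y)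
      -- Modulo coinvariants, `z⁻ʲ T^(j-i) y` is `z⁻ʲ z^(j-i) y = z⁻ⁱ y`.
      rw [hecke_pow_coe X hK hz, mkQ_ρ_idem X hK hz j (hz.ρ_pow_mem_inv_U X _ y.2)
        (hz.ρ_pow_mem_inv_M X _ (inv_mono X inf_le_left y.2)), ← X.ρ_mul]
      obtain ⟨k, rfl⟩ := Nat.exists_eq_add_of_le hij
      rw [Nat.add_sub_cancel_left, add_comm i k, pow_add]
      congr 3
      group

theorem indToJacquet_of (n : ℕ) (y : X.inv K.toSubgroup) :
    indToJacquet X hK hz (IndLim.of _ n y) = (D.coinvSub X).mkQ (X.ρ (z ^ n)⁻¹ y) :=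
  Module.DirectLimit.lift_of ..

theorem IndLim.exists_of {W : Type w} [AddCommGroup W] [Module R W] {T : Module.End R W}
    (a : IndLim T) : ∃ n y, IndLim.of T n y = a :=
  Module.DirectLimit.exists_of a

theorem indToJacquet_injective : Function.Injective (indToJacquet X hK hz) := by
  rw [injective_iff_map_eq_zero]
  intro a ha
  obtain ⟨n, y, rfl⟩ := IndLim.exists_of a
  rw [indToJacquet_of] at ha
  obtain ⟨m, hm⟩ := exists_idem_ρ_pow_eq_zero X hz ((Submodule.Quotient.mk_eq_zero _).1 ha)
  have h1 : (X.hecke K z ^ m) y = 0 := by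
    refine Subtype.ext ?_
    rw [hecke_pow_coe X hK hz]
    -- The exponent `m + n` cancels `z⁻ⁿ` and leaves `e_K zᵐ y = Tᵐ y`.
    have := hm (m + n) (Nat.le_add_right _ _)
    rwa [← X.ρ_mul, pow_add, mul_inv_cancel_right] at this
  have h2 : IndLim.of (X.hecke K z) (n + m) ((X.hecke K z ^ (n + m - n)) y) =
      IndLim.of (X.hecke K z) n y :=
    Module.DirectLimit.of_f (hij := Nat.le_add_right n m)
  rw [← h2, Nat.add_sub_cancel_left, h1, map_zero]

include hχ in
theorem indToJacquet_mem (a : IndLim (X.hecke K z)) :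
    indToJacquet X hK hz a ∈ D.jacquetInv X χ K.toSubgroup := by
  obtain ⟨n, y, rfl⟩ := IndLim.exists_of a
  rw [indToJacquet_of, mem_jacquetInv_iff X hχ]
  intro m hm
  change (D.coinvSub X).mkQ (X.ρ m (X.ρ (z ^ n)⁻¹ y)) = _
  rw [← X.ρ_mul, show (m : G) * (z ^ n)⁻¹ = (z ^ n)⁻¹ * (z ^ n * m * (z ^ n)⁻¹) by group,
    hz.conj_M' n m.2, X.ρ_mul, y.2 m hm]

include hχ in
theorem exists_indToJacquet_eq {q : D.Jacquet X} (hq : q ∈ D.jacquetInv X χ K.toSubgroup) :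
    ∃ a, indToJacquet X hK hz a = q := by
  rw [mem_jacquetInv_iff X hχ] at hq
  obtain ⟨v, rfl⟩ := Submodule.mkQ_surjective _ q
  -- Since the class of `v` is invariant under `K ∩ M`, averaging makes the representative itself
  -- invariant without changing its class.
  set v₀ := X.average (K.toSubgroup ⊓ D.M) v with hv₀
  have h0 : (D.coinvSub X).mkQ v₀ = (D.coinvSub X).mkQ v :=
    X.map_average _ K inf_le_left v fun m hm => hq ⟨m, hm.2⟩ hm.1
  have hM : v₀ ∈ X.inv (K.toSubgroup ⊓ D.M) := X.average_mem_inv K inf_le_left v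
  obtain ⟨N, hN, hNv⟩ := X.smooth v₀
  -- For this `n`, `z⁻ⁿ(K ∩ U)zⁿ` lies in the group `N` fixing `v₀`, so `zⁿ v₀` is fixed by `K ∩ U`.
  -- Hence `e_K zⁿ v₀` at index `n` is a preimage.
  obtain ⟨n, hn⟩ := hz.U_contract N hN
  refine ⟨IndLim.of _ n ⟨X.idem K (X.ρ (z ^ n) v₀), X.idem_mem_inv K _⟩, ?_⟩
  have hU : X.ρ (z ^ n) v₀ ∈ X.inv (K.toSubgroup ⊓ D.U) :=
    X.ρ_inv_mem_inv (H := N) hNv fun a ha => hn n le_rfl a ha.1 ha.2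
  rw [indToJacquet_of, mkQ_ρ_idem X hK hz n hU (hz.ρ_pow_mem_inv_M X n hM), ← X.ρ_mul,
    inv_mul_cancel, X.ρ_one, h0]

/-- The `K ∩ M`-invariants of the Jacquet module form an inductive limit. -/
def jacquetInvEquiv : D.jacquetInv X χ K.toSubgroup ≃ₗ[R] IndLim (X.hecke K z) :=
  (LinearEquiv.ofBijective ((indToJacquet X hK hz).codRestrict _ (indToJacquet_mem X hK hz hχ))
    ⟨fun _ _ h => indToJacquet_injective X hK hz (congrArg Subtype.val h), fun q =>
      (exists_indToJacquet_eq X hK hz hχ q.2).imp fun _ h => Subtype.ext h⟩).symm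

theorem jacquetInvEquiv_symm_of (n : ℕ) (y : X.inv K.toSubgroup) :
    ((jacquetInvEquiv X hK hz hχ).symm (IndLim.of _ n y) : D.Jacquet X) =
      (D.coinvSub X).mkQ (X.ρ (z ^ n)⁻¹ y) :=
  indToJacquet_of X hK hz n y

theorem jacquetInvEquiv_natural {X Y : SmoothRep.{u, v, w} R G} (f : X.Hom Y)
    (q : D.jacquetInv X χ K.toSubgroup) :
    jacquetInvEquiv Y hK hz hχ (D.jacquetInvMap f χ K.toSubgroup q) =
      IndLim.map (f.onInv K.toSubgroup) (f.onInv_hecke K z) (jacquetInvEquiv X hK hz hχ q) := by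
  obtain ⟨a, rfl⟩ := (jacquetInvEquiv X hK hz hχ).symm.surjective q
  obtain ⟨n, y, rfl⟩ := IndLim.exists_of a
  rw [LinearEquiv.apply_symm_apply, ← LinearEquiv.eq_symm_apply]
  have h1 : IndLim.map (f.onInv K.toSubgroup) (f.onInv_hecke K z) (IndLim.of (X.hecke K z) n y) =
      IndLim.of (Y.hecke K z) n (f.onInv K.toSubgroup y) := Module.DirectLimit.map_apply_of ..
  refine Subtype.ext ?_
  rw [h1, jacquetInvEquiv_symm_of]
  refine (congrArg (D.jacquetMap f) (jacquetInvEquiv_symm_of X hK hz hχ n y)).trans ?_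
  exact congrArg (D.coinvSub Y).mkQ (f.comm _ _)

end Inductive

end LeviTriple

end

noncomputable section

namespace LeviTriple

variable {p : ℕ} {R : Type v} {G : Type u} [Ring R] [Group G] [TopologicalSpace G]
  [IsTopologicalGroup G] [hp : Fact p.Prime] [Fact (IsUnit (p : R))] {D : LeviTriple G}
  (X : SmoothRep.{u, v, w} R G) {K : CompactOpenProP p G} {z : G}

/-! ### Invariant elements of the roughening -/

section Rough

theorem roughAct_apply (g : G) (x : CompactOpenProP p G → X.V) (L : CompactOpenProP p G) :
    roughAct p X g x L = X.ρ g (x (L.conj g⁻¹)) := rfl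

variable {χ : G → Subring.center R}

/-- Invariance under `L ∩ M` already implies smoothness because `L` is open, and the twist is
trivial on `L ∩ M`. -/
theorem mem_iStarInv_iff {L : CompactOpenProP p G} (hχ : ∀ m ∈ D.M, m ∈ L.toSubgroup → χ m = 1)
    {x : CompactOpenProP p G → X.V} : x ∈ D.iStarInv p X χ L.toSubgroup ↔
      x ∈ rough p X ∧ (∀ g ∈ D.U, roughAct p X g x = x) ∧
        ∀ m ∈ D.M, m ∈ L.toSubgroup → roughAct p X m x = x := by
  have h : ∀ m ∈ D.M, m ∈ L.toSubgroup → (χ m • roughAct p X m) x = roughAct p X m x :=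
    fun m hm hmL => by rw [hχ m hm hmL, one_smul]
  simp only [iStarInv, Submodule.mem_inf, Submodule.mem_iInf, LinearMap.mem_ker,
    LinearMap.sub_apply, sub_eq_zero, Module.End.one_apply]
  constructor
  · rintro ⟨⟨hr, hU, -⟩, hM⟩
    exact ⟨hr, hU, fun m hm hmL => (h m hm hmL).symm.trans (hM ⟨m, hm⟩ hmL)⟩
  · rintro ⟨hr, hU, hM⟩
    exact ⟨⟨hr, hU, L.toSubgroup, L.isOpen, fun m hm hmL => (h m hm hmL).trans (hM m hm hmL)⟩,
      fun m hmL => (h m m.2 hmL).trans (hM m m.2 hmL)⟩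

/-- Components at normal subgroups inherit invariance. -/
theorem apply_mem_inv_of_normal {x : CompactOpenProP p G → X.V} {J : CompactOpenProP p G}
    {H : Subgroup G} (hJ : ∀ g ∈ H, ∀ y, g * y * g⁻¹ ∈ J.toSubgroup ↔ y ∈ J.toSubgroup)
    (hx : ∀ g ∈ H, roughAct p X g x = x) : x J ∈ X.inv H := fun g hg => by
  have := congrFun (hx g hg) J
  rwa [roughAct_apply, CompactOpenProP.conj_eq_of_normal (hJ g hg)] at this

/-- An element of the roughening that is invariant under `L ∩ U` and `L ∩ M` has `e_{L'} x_L = x_{L'}`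
already if `L ∩ Ubar` is contained in `L'`. -/
theorem idem_apply_eq {L L' : CompactOpenProP p G} (hL : D.Decomposes L.toSubgroup)
    (hLL' : L.toSubgroup ⊓ D.Ubar ≤ L'.toSubgroup) {x : CompactOpenProP p G → X.V}
    (hx : x ∈ rough p X) (hU : ∀ g ∈ D.U, roughAct p X g x = x)
    (hM : ∀ m ∈ D.M, m ∈ L.toSubgroup → roughAct p X m x = x) : X.idem L' (x L) = x L' := by
  -- Both components are averages of `x J`. As `L` normalises `J`, the vector `x J` is fixed by `L ∩
  -- U` and `L ∩ M`, so passing to `x L` only averages over `L ∩ Ubar`, which `L'` absorbs.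
  obtain ⟨J, hJL, hJL', hJ⟩ := L.exists_normal L'.isOpen
  rw [← hx.2 J L hJL, ← hx.2 J L' hJL']
  refine hL.map_idem X (apply_mem_inv_of_normal X (fun g hg => hJ g hg.1) fun g hg => hU g hg.2)
    (apply_mem_inv_of_normal X (fun g hg => hJ g hg.1) fun g hg => hM g hg.2 hg.1) _ fun h hh hb =>
    X.idem_ρ L' (hLL' ⟨hh, hb⟩) _

end Rough

/-! ### The adjoint functor as a projective limit -/

section Projective

variable {χ : G → Subring.center R}

variable (hK : D.Decomposes K.toSubgroup) (hz : D.IsContracting K z)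
  (hχ : ∀ m ∈ D.M, m ∈ K.toSubgroup → χ m = 1)

include hz in
theorem IsContracting.mem_conj_pow_iff (n : ℕ) {m : G} (hm : m ∈ D.M) :
    m ∈ (K.conj (z ^ n)).toSubgroup ↔ m ∈ K.toSubgroup := by
  rw [CompactOpenProP.mem_conj, hz.conj_M n hm]

include hK hz hχ in
theorem idem_apply_conj_pow {x : CompactOpenProP p G → X.V} (hx : x ∈ D.iStarInv p X χ K.toSubgroup)
    (n : ℕ) {L : CompactOpenProP p G}
    (hL : ∀ y ∈ K.toSubgroup, y ∈ D.Ubar → z ^ n * y * (z ^ n)⁻¹ ∈ L.toSubgroup) :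
    X.idem L (x (K.conj (z ^ n))) = x L := by
  obtain ⟨hr, hU, hM⟩ := (mem_iStarInv_iff X hχ).1 hx
  refine idem_apply_eq X (hK.conj (hz.pow_mem n)) (fun y hy => ?_) hr hU fun m hm hmK =>
    hM m hm ((hz.mem_conj_pow_iff n hm).1 hmK)
  have h1 := hL _ (CompactOpenProP.mem_conj.1 hy.1) (by
    have := D.conj_Ubar _ (inv_mem (hz.pow_mem n)) y hy.2
    rwa [inv_inv] at this)
  simpa [mul_assoc] using h1

/-- The map `x ↦ ((z⁻ⁿ x)_K)ₙ`. -/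
def iStarToProj : D.iStarInv p X χ K.toSubgroup →ₗ[R] ProjLim (X.hecke K z) where
  toFun x := ⟨fun n => ⟨roughAct p X (z ^ n)⁻¹ x K, by
    rw [roughAct_apply]
    refine X.ρ_inv_mem_inv (((mem_iStarInv_iff X hχ).1 x.2).1.1 _) fun a ha => ?_
    simpa [CompactOpenProP.mem_conj, mul_assoc] using ha⟩, fun n => by
    refine Subtype.ext ?_
    rw [hecke_coe]
    simp only [roughAct_apply, inv_inv]
    -- Moving `z⁻ⁿ` out turns `e_K` into the idempotent of `zⁿKz⁻ⁿ`, applied to the component at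
    -- `zⁿ⁺¹Kz⁻⁽ⁿ⁺¹⁾`. The latter group need not lie in the former, as its part in `U` grows;
    -- containment of the parts in `Ubar` suffices.
    have h1 : X.ρ z (X.ρ (z ^ (n + 1))⁻¹ ((x : CompactOpenProP p G → X.V) (K.conj (z ^ (n + 1))))) =
        X.ρ (z ^ n)⁻¹ ((x : CompactOpenProP p G → X.V) (K.conj (z ^ (n + 1)))) := by
      rw [← X.ρ_mul, pow_succ]
      group
    have h2 := X.ρ_idem (z ^ n)⁻¹ (K.conj (z ^ n))
      ((x : CompactOpenProP p G → X.V) (K.conj (z ^ (n + 1))))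
    rw [CompactOpenProP.conj_conj, inv_mul_cancel, CompactOpenProP.conj_one] at h2
    rw [h1, ← h2, idem_apply_conj_pow X hK hz hχ x.2 (n + 1) fun y hy hyU => ?_]
    rw [CompactOpenProP.mem_conj]
    have := hz.Ubar_pow 1 y hy hyU
    rw [pow_one] at this
    convert this using 1
    rw [pow_succ]
    group⟩
  map_add' x y := by ext; simp [roughAct_apply]
  map_smul' r x := by ext; simp [roughAct_apply]

theorem iStarToProj_apply (x : D.iStarInv p X χ K.toSubgroup) (n : ℕ) :
    (((iStarToProj X hK hz hχ x : ℕ → X.inv K.toSubgroup) n : X.inv K.toSubgroup) : X.V) =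
      roughAct p X (z ^ n)⁻¹ x K := rfl

/-- For large `n` the component at `L` is `e_L` of the component at `zⁿKz⁻ⁿ`, which is `zⁿ` times
the `n`-th entry of the image. -/
theorem iStarToProj_injective : Function.Injective (iStarToProj X hK hz hχ) := by
  rw [injective_iff_map_eq_zero]
  intro x hx
  refine Subtype.ext (funext fun L => ?_)
  obtain ⟨n, hn⟩ := hz.Ubar_contract _ L.isOpen
  have h0 := iStarToProj_apply X hK hz hχ x n
  rw [hx, roughAct_apply, inv_inv] at h0
  have h1 : (x : CompactOpenProP p G → X.V) (K.conj (z ^ n)) = 0 :=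
    X.ρ_injective (z ^ n)⁻¹ (by rw [← h0, map_zero]; rfl)
  rw [← idem_apply_conj_pow X hK hz hχ x.2 n (hn n le_rfl), h1, map_zero]
  rfl

include hK hz in
-- Here `yₙ = e_K z yₙ₊₁` is an average over `K ∩ Ubar`, which `zⁿ` moves into `L`.
theorem idem_ρ_pow_succ {y : ℕ → X.inv K.toSubgroup} (hy : y ∈ ProjLim (X.hecke K z)) (n : ℕ)
    {L : CompactOpenProP p G}
    (hL : ∀ x ∈ K.toSubgroup, x ∈ D.Ubar → z ^ n * x * (z ^ n)⁻¹ ∈ L.toSubgroup) :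
    X.idem L (X.ρ (z ^ (n + 1)) (y (n + 1))) = X.idem L (X.ρ (z ^ n) (y n)) := by
  have h1 : ((y n : X.inv K.toSubgroup) : X.V) = X.idem K (X.ρ (z ^ 1) (y (n + 1))) := by
    rw [← hy n, hecke_coe, pow_one]
  have h2 := hK.map_idem X (hz.ρ_pow_mem_inv_U X 1 (y (n + 1)).2)
    (hz.ρ_pow_mem_inv_M X 1 (inv_mono X inf_le_left (y (n + 1)).2)) (X.idem L ∘ₗ X.ρ (z ^ n))
    fun h hh hU => by
      change X.idem L (X.ρ (z ^ n) (X.ρ h _)) = X.idem L (X.ρ (z ^ n) _)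
      rw [← X.idem_ρ L (hL h hh hU) (X.ρ (z ^ n) (X.ρ (z ^ 1) (y (n + 1))))]
      simp only [← X.ρ_mul, inv_mul_cancel_right, ← mul_assoc]
  rw [h1]
  refine Eq.trans ?_ h2.symm
  change _ = X.idem L (X.ρ (z ^ n) (X.ρ (z ^ 1) _))
  rw [← X.ρ_mul, ← pow_add]

include hK hz in
theorem idem_ρ_pow_eq {y : ℕ → X.inv K.toSubgroup} (hy : y ∈ ProjLim (X.hecke K z)) {n : ℕ}
    {L : CompactOpenProP p G}
    (hL : ∀ m ≥ n, ∀ x ∈ K.toSubgroup, x ∈ D.Ubar → z ^ m * x * (z ^ m)⁻¹ ∈ L.toSubgroup)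
    {m : ℕ} (hm : n ≤ m) :
    X.idem L (X.ρ (z ^ m) (y m)) = X.idem L (X.ρ (z ^ n) (y n)) := by
  induction m, hm using Nat.le_induction with
  | base => rfl
  | succ m hm ih => rw [idem_ρ_pow_succ X hK hz hy m (hL m hm), ih]

include hK hz in
/-- The sequence `e_L zⁿ yₙ` is eventually constant, and its limits define an element of `i*`. -/
theorem exists_iStar_lift {y : ℕ → X.inv K.toSubgroup} (hy : y ∈ ProjLim (X.hecke K z)) :
    ∃ x : CompactOpenProP p G → X.V, ∀ L, ∃ n, ∀ m ≥ n, X.idem L (X.ρ (z ^ m) (y m)) = x L := by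
  choose n hn using fun L : CompactOpenProP p G => hz.Ubar_contract _ L.isOpen
  -- The witness found by unification is `L ↦ e_L zᵐ yₘ` with `m = n L`.
  exact ⟨_, fun L => ⟨n L, fun m hm => idem_ρ_pow_eq X hK hz hy (hn L) hm⟩⟩

include hχ in
theorem exists_iStarToProj_eq (y : ProjLim (X.hecke K z)) : ∃ x, iStarToProj X hK hz hχ x = y := by
  obtain ⟨x, hx⟩ := exists_iStar_lift X hK hz y.2
  -- One criterion serves both `U` and `K ∩ M`: if `z⁻ᵐ g zᵐ ∈ K`, then `g` fixes `zᵐ yₘ`. The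
  -- exponent `m` has to be large enough for both `L` and `g⁻¹Lg`.
  have hact : ∀ g : G, (∃ n, ∀ m ≥ n, (z ^ m)⁻¹ * g * z ^ m ∈ K.toSubgroup) →
      roughAct p X g x = x := by
    rintro g ⟨n₀, h₀⟩
    funext L
    obtain ⟨n₁, h₁⟩ := hx L
    obtain ⟨n₂, h₂⟩ := hx (L.conj g⁻¹)
    set m := max n₀ (max n₁ n₂)
    have hg := (y : ℕ → X.inv K.toSubgroup) m |>.2 _ (h₀ m (le_max_left _ _))
    rw [roughAct_apply, ← h₁ m ((le_max_left _ _).trans (le_max_right _ _)),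
      ← h₂ m ((le_max_right _ _).trans (le_max_right _ _)), X.ρ_idem, CompactOpenProP.conj_conj,
      mul_inv_cancel, CompactOpenProP.conj_one, ← X.ρ_mul,
      show g * z ^ m = z ^ m * ((z ^ m)⁻¹ * g * z ^ m) by group, X.ρ_mul, hg]
  refine ⟨⟨x, (mem_iStarInv_iff X hχ).2 ⟨⟨fun L => ?_, fun L' L h => ?_⟩, fun g hg => ?_,
    fun m hm hmK => ?_⟩⟩, ?_⟩
  · obtain ⟨n, hn⟩ := hx L
    rw [← hn n le_rfl]
    exact X.idem_mem_inv L _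
  · obtain ⟨n, hn⟩ := hx L
    obtain ⟨n', hn'⟩ := hx L'
    rw [← hn _ (le_max_left n n'), ← hn' _ (le_max_right n n'), X.idem_idem h]
  · exact hact g (hz.U_exhaust g hg)
  · exact hact m ⟨0, fun k _ => by rwa [hz.conj_M k hm]⟩
  · refine Subtype.ext (funext fun i => Subtype.ext ?_)
    rw [iStarToProj_apply, roughAct_apply, inv_inv]
    obtain ⟨n, hn⟩ := hx (K.conj (z ^ i))
    -- At `L = zⁱKz⁻ⁱ` the sequence is constant from `m = i` on, so the component is `e_L zⁱ yᵢ = zⁱ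
    -- e_K yᵢ = zⁱ yᵢ`.
    have h1 := idem_ρ_pow_eq X hK hz y.2 (n := i) (L := K.conj (z ^ i)) (fun m hm a ha haU => by
      rw [CompactOpenProP.mem_conj]
      obtain ⟨k, rfl⟩ := Nat.exists_eq_add_of_le hm
      convert hz.Ubar_pow k a ha haU using 1
      rw [pow_add]
      group) (le_max_right n i)
    rw [hn _ (le_max_left n i)] at h1
    change X.ρ (z ^ i)⁻¹ (x (K.conj (z ^ i))) = _
    rw [h1, ← X.ρ_idem, X.idem_of_mem_inv ((y : ℕ → X.inv K.toSubgroup) i).2, ← X.ρ_mul,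
      inv_mul_cancel, X.ρ_one]

/-- The `K ∩ M`-invariants of `i*` form a projective limit. -/
def iStarInvEquiv : D.iStarInv p X χ K.toSubgroup ≃ₗ[R] ProjLim (X.hecke K z) :=
  LinearEquiv.ofBijective (iStarToProj X hK hz hχ)
    ⟨iStarToProj_injective X hK hz hχ, exists_iStarToProj_eq X hK hz hχ⟩

theorem iStarInvEquiv_apply (x : D.iStarInv p X χ K.toSubgroup) (n : ℕ) :
    (((iStarInvEquiv X hK hz hχ x : ℕ → X.inv K.toSubgroup) n : X.inv K.toSubgroup) : X.V) =
      roughAct p X (z ^ n)⁻¹ x K := rfl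

theorem iStarInvEquiv_natural {X Y : SmoothRep.{u, v, w} R G} (f : X.Hom Y)
    (x : D.iStarInv p X χ K.toSubgroup) :
    iStarInvEquiv Y hK hz hχ (D.iStarInvMap f χ K.toSubgroup x) =
      ProjLim.map (f.onInv K.toSubgroup) (f.onInv_hecke K z) (iStarInvEquiv X hK hz hχ x) :=
  Subtype.ext (funext fun n => Subtype.ext (f.comm (z ^ n)⁻¹ _).symm)

end Projective

/-! ### Independence of the natural map from the subgroup -/

section Natural

variable {χ : G → Subring.center R} (hz : D.IsContracting K z)

include hz in
/-- The natural map `i* → r` does not depend on the choice of a subgroup in good position. -/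
theorem naturalMap_eq {L L' : CompactOpenProP p G} (hL : D.Decomposes L.toSubgroup)
    (hL' : D.Decomposes L'.toSubgroup) (hUbar : IsClosed (D.Ubar : Set G))
    (hχ : ∀ m ∈ D.M, m ∈ L.toSubgroup → χ m = 1) (hχ' : ∀ m ∈ D.M, m ∈ L'.toSubgroup → χ m = 1)
    {x : CompactOpenProP p G → X.V} (hx : x ∈ D.iStarInv p X χ L.toSubgroup)
    (hx' : x ∈ D.iStarInv p X χ L'.toSubgroup) : D.naturalMap X L x = D.naturalMap X L' x := by
  obtain ⟨n₁, h₁⟩ := hz.Ubar_exhaust _ (L.isCompact.inter_right hUbar) Set.inter_subset_right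
  obtain ⟨n₂, h₂⟩ := hz.Ubar_exhaust _ (L'.isCompact.inter_right hUbar) Set.inter_subset_right
  -- The group `C = z⁻ⁿKzⁿ ∩ Ubar` contains both `L ∩ Ubar` and `L' ∩ Ubar`.
  set n := max n₁ n₂
  set B := K.conj (z ^ n)⁻¹
  set C := B.toSubgroup ⊓ D.Ubar
  have hmem : ∀ a, a ∈ D.Ubar → z ^ n * a * (z ^ n)⁻¹ ∈ K.toSubgroup → a ∈ C := fun a ha h =>
    ⟨CompactOpenProP.mem_conj.2 (by rwa [inv_inv]), ha⟩
  obtain ⟨N₁, hN₁, hf₁⟩ := X.smooth (X.average C (x L))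
  obtain ⟨N₂, hN₂, hf₂⟩ := X.smooth (X.average C (x L'))
  -- `J` is small enough to fix both `C`-averages, so the open group `S = C J` fixes them too. They
  -- then both equal `x S`, while averaging over `C ⊆ Ubar` preserves the class.
  obtain ⟨J, hJB, hJN, hJ⟩ := B.exists_normal (N := N₁ ⊓ N₂) (hN₁.inter hN₂)
  obtain ⟨S, hS⟩ := B.exists_sup J hJB hJ (H := C) inf_le_left
  have hCS : C ≤ S.toSubgroup := fun c hc => (hS c).2 ⟨c, hc, 1, J.toSubgroup.one_mem, by simp⟩
  have key : ∀ A : CompactOpenProP p G, D.Decomposes A.toSubgroup → A.toSubgroup ⊓ D.Ubar ≤ C →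
      (∀ m ∈ D.M, m ∈ A.toSubgroup → χ m = 1) → x ∈ D.iStarInv p X χ A.toSubgroup →
      (∀ g ∈ J.toSubgroup, X.ρ g (X.average C (x A)) = X.average C (x A)) →
      D.naturalMap X A x = (D.coinvSub X).mkQ (x S) := by
    intro A hA hAC hχA hxA hJA
    obtain ⟨hr, hU, hM⟩ := (mem_iStarInv_iff X hχA).1 hxA
    have h1 : X.idem S (x A) = x S := idem_apply_eq X hA (hAC.trans hCS) hr hU hM
    have h2 : X.idem S (x A) = X.average C (x A) := by
      rw [← X.idem_average S hCS, X.idem_of_mem_inv]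
      intro s hs
      obtain ⟨c, hc, j, hj, rfl⟩ := (hS s).1 hs
      rw [X.ρ_mul, hJA j hj, X.average_mem_inv B inf_le_left _ c hc]
    rw [← h1, h2]
    exact (X.map_average _ B inf_le_left _ fun h hh => mkQ_ρ X hh.2 _).symm
  rw [key L hL (fun a ha => hmem a ha.2 (h₁ n (le_max_left _ _) a ha)) hχ hx
      fun g hg => hf₁ g (hJN hg).1,
    key L' hL' (fun a ha => hmem a ha.2 (h₂ n (le_max_right _ _) a ha)) hχ' hx'
      fun g hg => hf₂ g (hJN hg).2]

end Natural

end LeviTriple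

end

/-! ### Closedness of rational points, and the main theorem -/

/-- The rational points of a Zariski-closed subgroup over an extension field are closed. -/
theorem AlgGroup.isClosed_points {k : Type u} [Field k] {n : ℕ} {F : Type v} [Field F] [Algebra F k]
    [TopologicalSpace F] [IsTopologicalRing F] [T1Space F] {H : Subgroup (GL (Fin n) k)}
    (hH : AlgGroup.IsZariskiClosed H) : IsClosed (AlgGroup.points F H : Set (GL (Fin n) F)) := by
  -- No topology on `k` is used: `F`-linear functionals on `k` detect zero and turn each equation
  -- over `k` into polynomial equations over `F`.
  have hset : (AlgGroup.points F H : Set (GL (Fin n) F)) =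
      ⋂ f ∈ MvPolynomial.vanishingIdeal k (AlgGroup.entries '' (H : Set (GL (Fin n) k))),
        ⋂ φ : Module.Dual F k, {g : GL (Fin n) F | φ (MvPolynomial.eval
          (AlgGroup.entries (Matrix.GeneralLinearGroup.map (algebraMap F k) g)) f) = 0} := by
    ext g
    simp only [SetLike.mem_coe, Set.mem_iInter, Set.mem_ofPred_eq,
      Module.forall_dual_apply_eq_zero_iff]
    refine ⟨fun hg f hf => ?_, fun h => hH _ h⟩
    exact (MvPolynomial.mem_vanishingIdeal_iff.1 hf) _ (Set.mem_image_of_mem _ hg)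
  rw [hset]
  refine isClosed_biInter fun f _ => isClosed_iInter fun φ => ?_
  have heval : ∀ g : GL (Fin n) F, φ (MvPolynomial.eval
      (AlgGroup.entries (Matrix.GeneralLinearGroup.map (algebraMap F k) g)) f) =
      ∑ d ∈ f.support, (∏ i ∈ d.support, ((g : Matrix (Fin n) (Fin n) F) i.1 i.2) ^ d i) *
        φ (f.coeff d) := by
    intro g
    rw [MvPolynomial.eval_eq, map_sum]
    refine Finset.sum_congr rfl fun d _ => ?_
    rw [← smul_eq_mul (_ : F), ← map_smul, Algebra.smul_def, map_prod, mul_comm]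
    simp [AlgGroup.entries]
  have hcont : Continuous fun g : GL (Fin n) F => φ (MvPolynomial.eval
      (AlgGroup.entries (Matrix.GeneralLinearGroup.map (algebraMap F k) g)) f) := by
    simp only [heval]
    refine continuous_finsetSum _ fun d _ => Continuous.mul (continuous_finsetProd _ fun i _ =>
      Continuous.pow ?_ _) continuous_const
    exact Units.continuous_val.matrix_elem i.1 i.2
  exact isClosed_singleton.preimage hcont

theorem mainTheorem4
    {F : Type u} [Field F] [ValuativeRel F] [TopologicalSpace F] [IsNonarchimedeanLocalField F]
    (p : ℕ) [CharP 𝓀[F] p]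
    {n : ℕ} (H P Q U Ubar : Subgroup (GL (Fin n) (AlgebraicClosure F)))
    (hH : AlgGroup.IsConnectedReductive H) (hHF : AlgGroup.IsDefinedOver F H)
    (hPQ : AlgGroup.IsOppositeParabolicPair F H P Q U Ubar)
    {R : Type v} [Ring R] [Fact (IsUnit (p : R))] (s : (Subring.center R)ˣ)
    (K : CompactOpenProP p (AlgGroup.points F H))
    (hK : (AlgGroup.leviTriple hPQ).IsInGoodPosition K.toSubgroup)
    (z : AlgGroup.points F H)
    (hz : (AlgGroup.leviTriple hPQ).IsStrictlyPositive K.toSubgroup z) :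
    let G := AlgGroup.points F H
    let D : LeviTriple G := AlgGroup.leviTriple hPQ
    let χ : G → Subring.center R := modularTwist p s (K.toSubgroup ⊓ D.Ubar)
    ∃ (Φ : ∀ X : SmoothRep.{u, v, w} R G,
          D.jacquetInv X χ K.toSubgroup ≃ₗ[R] IndLim (X.hecke K z))
      (Ψ : ∀ X : SmoothRep.{u, v, w} R G,
          D.iStarInv p X χ K.toSubgroup ≃ₗ[R] ProjLim (X.hecke K z)),
      -- the isomorphisms are natural
      (∀ (X Y : SmoothRep.{u, v, w} R G) (f : X.Hom Y) (q : D.jacquetInv X χ K.toSubgroup),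
        Φ Y (D.jacquetInvMap f χ K.toSubgroup q) =
          IndLim.map (f.onInv K.toSubgroup) (f.onInv_hecke K z) (Φ X q)) ∧
      (∀ (X Y : SmoothRep.{u, v, w} R G) (f : X.Hom Y) (x : D.iStarInv p X χ K.toSubgroup),
        Ψ Y (D.iStarInvMap f χ K.toSubgroup x) =
          ProjLim.map (f.onInv K.toSubgroup) (f.onInv_hecke K z) (Ψ X x)) ∧
      -- explicit formulas
      (∀ (X : SmoothRep.{u, v, w} R G) (i : ℕ) (y : X.inv K.toSubgroup),
        ((Φ X).symm (IndLim.of (X.hecke K z) i y) : D.Jacquet X) =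
          (D.coinvSub X).mkQ (X.ρ (z ^ i)⁻¹ y)) ∧
      (∀ (X : SmoothRep.{u, v, w} R G) (x : D.iStarInv p X χ K.toSubgroup) (i : ℕ),
        (((Ψ X x : ℕ → X.inv K.toSubgroup) i : X.inv K.toSubgroup) : X.V) =
          LeviTriple.roughAct p X (z ^ i)⁻¹ x K) ∧
      -- the natural map `i* → r` becomes the map from the projective to the inductive limit
      (∀ (X : SmoothRep.{u, v, w} R G) (x : D.iStarInv p X χ K.toSubgroup)
        (L : CompactOpenProP p G), D.IsInGoodPosition L.toSubgroup →
        (x : CompactOpenProP p G → X.V) ∈ D.iStarInv p X χ L.toSubgroup →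
        ((Φ X).symm (projToInd (X.hecke K z) (Ψ X x)) : D.Jacquet X) =
          D.naturalMap X L x) := by
  intro G D χ
  have hp : Fact p.Prime := ⟨CharP.char_is_prime 𝓀[F] p⟩
  have hT : T1Space F := by
    let := IsTopologicalAddGroup.rightUniformSpace F
    have := isUniformAddGroup_of_addCommGroup (G := F)
    infer_instance
  have hU : IsClosed (D.U : Set G) :=
    (AlgGroup.isClosed_points hPQ.radical_left.1.2.2.1.1).preimage continuous_subtype_val
  have hUbar : IsClosed (D.Ubar : Set G) :=
    (AlgGroup.isClosed_points hPQ.radical_right.1.2.2.1.1).preimage continuous_subtype_val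
  have hχ : ∀ L : CompactOpenProP p G, ∀ m ∈ D.M, m ∈ L.toSubgroup → χ m = 1 :=
    fun L m hm hmL => LeviTriple.modularTwist_eq_one_of_mem s K L hm hmL
  have hz' : D.IsContracting K z := hz.isContracting hU hUbar
  have hK' : D.Decomposes K.toSubgroup := hK.decomposes
  refine ⟨fun X => LeviTriple.jacquetInvEquiv X hK' hz' (hχ K),
    fun X => LeviTriple.iStarInvEquiv X hK' hz' (hχ K),
    fun X Y f q => LeviTriple.jacquetInvEquiv_natural hK' hz' (hχ K) f q,
    fun X Y f x => LeviTriple.iStarInvEquiv_natural hK' hz' (hχ K) f x,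
    fun X i y => LeviTriple.jacquetInvEquiv_symm_of X hK' hz' (hχ K) i y,
    fun X x i => LeviTriple.iStarInvEquiv_apply X hK' hz' (hχ K) x i,
    fun X x L hL hxL => ?_⟩
  refine (LeviTriple.jacquetInvEquiv_symm_of X hK' hz' (hχ K) 0 _).trans ?_
  -- It suffices to evaluate the natural map at `K`, whose component of `x` is the entry of index
  -- `0` of the projective system.
  rw [LeviTriple.naturalMap_eq X hz' hL.decomposes hK' hUbar (hχ L) (hχ K) hxL x.2]
  change (D.coinvSub X).mkQ (X.ρ (z ^ 0)⁻¹ (LeviTriple.roughAct p X (z ^ 0)⁻¹ x K)) = _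
  rw [LeviTriple.roughAct_apply]
  simp only [pow_zero, inv_one, CompactOpenProP.conj_one, SmoothRep.ρ_one]
  rfl
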